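/- Let $F$ be a probability distribution on $[0,\infty)$ with continuous distribution function $F(x)$, let $n \ge 0$, and let $X_1,\dots,X_n$ be independent random variables with distribution $F$, with $\mathcal F_i = \sigma(X_1,\dots,X_i)$. A feasible policy $\pi$ decides, for each $1\le i\le n$, at time $i$ and by an $\mathcal F_i$-measurable rule, whether to accept $X_i$, in such a way that the accepted values form a nondecreasing sequence. Let $L_i(\pi)$ be the number of accepted observations among $X_1,\dots,X_i$, and let $M_i(\pi)$ be the last (that is, the largest) accepted value among them, with $M_i(\pi)=0$ if there is none. A feasible policy is optimal if it maximizes $\mathbb E[L_n(\pi)]$ over all feasible policies. Let the value functions be given by $v_0(s)=0$ and, for $k\ge1$, $$v_k(s) = F(s)\,v_{k-1}(s) + \int_s^\infty \max\{v_{k-1}(s),\, 1+v_{k-1}(x)\}\,dF(x),$$ and let $$h_k(s)=\sup\{x\in[s,\infty): F(x)<1 \text{ and } v_{k-1}(s)\le 1+v_{k-1}(x)\}\in[-\infty,\infty].$$ The policy that accepts $X_i$ if and only if $X_i\in[M_{i-1},h_{n-i+1}(M_{i-1})]$ (with $M_0=0$, and $M_i=X_i$ if $X_i$ is accepted, $M_i=M_{i-1}$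 otherwise) is feasible and optimal. Moreover, for every optimal policy $\pi^*_n$, with $L_i=L_i(\pi_n^*)$, $M_i=M_i(\pi_n^*)$ and $$w_{n-i}(M_i) = \mathrm{Var}[\,L_n-L_i \mid \mathcal F_i\,],$$ one has for all $0\le i\le n$, almost surely, $$\tfrac13\, v_{n-i}(M_i) - 2 \;\le\; w_{n-i}(M_i) \;\le\; \tfrac13\, v_{n-i}(M_i) + \tfrac23\{1+\log(n-i)\},$$ and in particular $$\tfrac13\,\mathbb E[L_n] - 2 \;\le\; \mathrm{Var}[L_n] \;\le\; \tfrac13\,\mathbb E[L_n] + \tfrac23\{1+\log n\}.$$ Here $\log 0$ is read as $0$; this concerns only the upper bound for $i=n$ (and the last one for $n=0$), where $w_0=v_0=0$. -/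

import Mathlib

open MeasureTheory ProbabilityTheory

noncomputable section

namespace OnlineSelection

/-- The value functions `v_k(s)` of the selection problem with observation law `F`, given by the
Bellman recursion: `v_0 = 0` and
`v_{k+1}(s) = F(s) v_k(s) + ∫_s^∞ max {v_k(s), 1 + v_k(x)} dF(x)`,
where `F(s) = F((-∞, s])` is the distribution function. -/
def value (F : Measure ℝ) : ℕ → ℝ → ℝ
  | 0, _ => 0
  | k + 1, s =>
      cdf F s * value F k s + ∫ x in Set.Ioi s, max (value F k s) (1 + value F k x) ∂F

/-- The optimal threshold
`h_k(s) = sup {x ∈ [s, ∞) : F(x) < 1 and v_{k-1}(s) ≤ 1 + v_{k-1}(x)}` for `k ≥ 1`.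
The supremum is taken in the extended reals: it is `∞` when the set is unbounded, and `-∞` when
the set is empty (in which case the interval `[s, h_k(s)]` is empty). -/
def threshold (F : Measure ℝ) (k : ℕ) (s : ℝ) : EReal :=
  sSup ((fun x : ℝ => (x : EReal)) ''
    {x : ℝ | s ≤ x ∧ cdf F x < 1 ∧ value F (k - 1) s ≤ 1 + value F (k - 1) x})

variable {Ω : Type*}

/-- The `σ`-field `ℱ_i = σ(X_1, …, X_i)`. -/
abbrev history (X : ℕ → Ω → ℝ) (i : ℕ) : MeasurableSpace Ω :=
  ⨆ j ∈ Finset.Icc 1 i, MeasurableSpace.comap (X j) inferInstance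

/-- A feasible online selection policy for `X_1, …, X_n`. It is described by the events
`S i = {X_i is accepted}`, `1 ≤ i ≤ n`. The decision at time `i` depends on `X_1, …, X_i` only
(equivalently, the successive selection times `τ_1 < τ_2 < ⋯` are stopping times), and the
accepted values form a nondecreasing sequence. -/
structure IsPolicy (X : ℕ → Ω → ℝ) (n : ℕ) (S : ℕ → Set Ω) : Prop where
  adapted : ∀ i ∈ Finset.Icc 1 n, MeasurableSet[history X i] (S i)
  monotone : ∀ i ∈ Finset.Icc 1 n, ∀ j ∈ Finset.Icc 1 n, i < j →
    ∀ ω, ω ∈ S i → ω ∈ S j → X i ω ≤ X j ω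

/-- `L_i`, the number of observations among `X_1, …, X_i` that are accepted. -/
def count (S : ℕ → Set Ω) (i : ℕ) (ω : Ω) : ℝ :=
  ∑ j ∈ Finset.Icc 1 i, (S j).indicator (fun _ => (1 : ℝ)) ω

/-- `M_i`, the most recently accepted value (hence the largest one, for a feasible policy) among
`X_1, …, X_i`, with `M_i = 0` as long as nothing has been accepted. -/
def lastSelected (X : ℕ → Ω → ℝ) (S : ℕ → Set Ω) : ℕ → Ω → ℝ
  | 0, _ => 0
  | i + 1, ω =>
      open scoped Classical in
      if ω ∈ S (i + 1) then X (i + 1) ω else lastSelected X S i ω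

/-- A policy is optimal if it is feasible and it maximizes the expected number of selections among
all feasible policies. -/
def IsOptimalPolicy [MeasurableSpace Ω] (μ : Measure Ω) (X : ℕ → Ω → ℝ) (n : ℕ)
    (S : ℕ → Set Ω) : Prop :=
  IsPolicy X n S ∧
    ∀ T : ℕ → Set Ω, IsPolicy X n T → ∫ ω, count T n ω ∂μ ≤ ∫ ω, count S n ω ∂μ

/-- The process `M_0 = 0`, with `M_i = X_i` if `X_i ∈ [M_{i-1}, h_{n-i+1}(M_{i-1})]` and
`M_i = M_{i-1}` otherwise. Below, time `i + 1` uses the threshold `h_{n-(i+1)+1} = h_{n-i}`. -/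
def thresholdMax (F : Measure ℝ) (X : ℕ → Ω → ℝ) (n : ℕ) : ℕ → Ω → ℝ
  | 0, _ => 0
  | i + 1, ω =>
      open scoped Classical in
      if thresholdMax F X n i ω ≤ X (i + 1) ω ∧
          (X (i + 1) ω : EReal) ≤ threshold F (n - i) (thresholdMax F X n i ω)
      then X (i + 1) ω else thresholdMax F X n i ω

/-- The threshold policy: accept `X_i` if and only if
`X_i ∈ [M_{i-1}, h_{n-i+1}(M_{i-1})]`, for `1 ≤ i ≤ n`. -/
def thresholdPolicy (F : Measure ℝ) (X : ℕ → Ω → ℝ) (n : ℕ) (i : ℕ) : Set Ω :=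
  {ω | thresholdMax F X n (i - 1) ω ≤ X i ω ∧
    (X i ω : EReal) ≤ threshold F (n - (i - 1)) (thresholdMax F X n (i - 1) ω)}

/-- The last value selected by the threshold policy is the process `thresholdMax`. -/
theorem lastSelected_thresholdPolicy (F : Measure ℝ) (X : ℕ → Ω → ℝ) (n i : ℕ) (ω : Ω) :
    lastSelected X (thresholdPolicy F X n) i ω = thresholdMax F X n i ω := by
  induction i with
  | zero => rfl
  | succ i ih => simp only [lastSelected, thresholdMax, thresholdPolicy, Set.mem_ofPred_eq,
      Nat.add_sub_cancel, ih]

end OnlineSelection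

end

/-!
The distribution function maps the observations to uniform variables, and `value F k` is the
uniform value function `unifValue k` on that scale (`map_cdf_eq`, `value_eq`).

*Optimality.* For a feasible policy, `L_i + v_{n-i}(M_i)` is a supermartingale: given the past, no
decision can increase it by more than the Bellman decision does, whose increment has mean zero
(`policyIncrement_le`, `integral_increment`). Hence `v_n(0)` bounds the expected number of
acceptances. The threshold policy attains the bound, and every policy that attains it takes the
Bellman decision almost surely at each time, because ties have probability zero
(`IsSample.isBellman_of_le`).

*Reduction of the variance bounds.* Under the Bellman decisions, `L_n - L_i - v_{n-i}(M_i)` is a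
sum of martingale differences, so its conditional second moment, which is the conditional variance
of `L_n - L_i`, is a sum of one-step terms. Write `f = v_k` for the continuation value, `s` for
the last accepted value, `[s, s + ℓ]` for the acceptance interval, `g(x) = 1 + f(x) - f(s)` and
`Δ = ∫ g` over that interval. The one-step term is `∫ g² - Δ²`. Since `v_{n-i}(M_i)` is the
expected sum of the acceptance probabilities `ℓ`, the one-step terms have to be compared with
`ℓ / 3`.

*Lower bound.* By concavity `g` lies above its chord, so `∫ g² ≥ ℓ / 3`. Moreover `Δ² ≤ ℓ²`, which
is twice the expected advance of the last accepted value; these advances sum to at most `1`, so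
that the total loss is at most `2` (`le_integral_increment_sq`).

*Upper bound.* Let `p = -f'`. The tangent at `s` gives `∫ g² ≤ 1 / (3 p(s))`. Two facts about the
Bellman recursion show that the acceptance interval is nearly as long as the tangent suggests,
`1 / p(s) ≤ ℓ + 1 / k`: the function `(1 - s) p(s)` is nonincreasing (`IsProfile.succ`), and
`(1 - s) p_k(s) ≥ k (v_k(s) - v_{k-1}(s))` (`succ_mul_gain_le_slope`). The errors `1 / (3 k)` add
up to a harmonic sum (`integral_sq_le`).
-/

noncomputable section

namespace OnlineSelection

open Set Filter Topology

/-! ### The uniform value functions -/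

/-- The increment `∫_s^1 (1 + f x - f s)⁺ dx` of one step of the Bellman recursion for uniform
observations, when `f` is the value function with one observation fewer. -/
def gain (f : ℝ → ℝ) (s : ℝ) : ℝ := ∫ x in s..1, max 0 (1 + f x - f s)

/-- The largest value in `[s, 1]` that is worth accepting when the last accepted value is `s` and
the continuation value is `f`. -/
def reach (f : ℝ → ℝ) (s : ℝ) : ℝ := sSup {x | x ∈ Icc s 1 ∧ f s ≤ 1 + f x}

/-- If `f` has derivative `-p`, then `f + gain f` has derivative `-nextSlope f p`. -/
def nextSlope (f p : ℝ → ℝ) (s : ℝ) : ℝ := 1 + (1 - (reach f s - s)) * p s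

/-- The value functions of the selection problem with uniform observations on `[0, 1]`. -/
def unifValue : ℕ → ℝ → ℝ
  | 0, _ => 0
  | k + 1, s => unifValue k s + gain (unifValue k) s

/-- The negative derivatives of the functions `unifValue k`. -/
def slope : ℕ → ℝ → ℝ
  | 0, _ => 0
  | k + 1, s => nextSlope (unifValue k) (slope k) s

/-- The regularity of the uniform value functions that the Bellman recursion preserves: `f` is
concave on `[0, 1]` with derivative `-p`, and `(1 - s) p s` is nonincreasing, that is, `f` is convex
as a function of `log (1 - s)`. -/
structure IsProfile (f p : ℝ → ℝ) : Prop where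
  contf : Continuous f
  contp : ContinuousOn p (Icc 0 1)
  deriv : ∀ x ∈ Ioo (0 : ℝ) 1, HasDerivAt f (-p x) x
  one : f 1 = 0
  nonneg : ∀ x ∈ Icc (0 : ℝ) 1, 0 ≤ p x
  mono : MonotoneOn p (Icc 0 1)
  anti : AntitoneOn (fun s => (1 - s) * p s) (Icc 0 1)

theorem continuous_gain {f : ℝ → ℝ} (hf : Continuous f) : Continuous (gain f) := by
  have h1 : Continuous (fun s => ∫ x in (1 : ℝ)..s, max 0 (1 + f x - f s)) := by
    refine intervalIntegral.continuous_parametric_intervalIntegral_of_continuous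
      (f := fun s x => max 0 (1 + f x - f s)) (s := fun s => s) ?_ continuous_id
    simp only [Function.uncurry_def]
    fun_prop
  have h2 : gain f = fun s => -∫ x in (1 : ℝ)..s, max 0 (1 + f x - f s) := by
    funext s
    rw [gain, intervalIntegral.integral_symm]
  rw [h2]
  exact h1.neg

theorem continuous_unifValue (k : ℕ) : Continuous (unifValue k) := by
  induction k with
  | zero => exact continuous_const
  | succ k ih => exact ih.add (continuous_gain ih)

namespace IsProfile

variable {f p : ℝ → ℝ} (H : IsProfile f p) {s t a b c x : ℝ}
include H

theorem intervalIntegrable (ha : 0 ≤ a) (hab : a ≤ b) (hb : b ≤ 1) :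
    IntervalIntegrable p volume a b := by
  refine (H.contp.mono ?_).intervalIntegrable
  rw [uIcc_of_le hab]
  exact Icc_subset_Icc ha hb

theorem integral_slope (ha : 0 ≤ a) (hab : a ≤ b) (hb : b ≤ 1) :
    ∫ x in a..b, p x = f a - f b := by
  have h := intervalIntegral.integral_eq_sub_of_hasDerivAt_of_le (f := fun x => -f x) (f' := p)
    hab H.contf.neg.continuousOn
    (fun x hx => by
      simpa using! (H.deriv x ⟨ha.trans_lt hx.1, hx.2.trans_le hb⟩).neg)
    (H.intervalIntegrable ha hab hb)
  rw [h]; ring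

theorem antitone (ha : 0 ≤ a) (hab : a ≤ b) (hb : b ≤ 1) : f b ≤ f a := by
  have h1 := H.integral_slope ha hab hb
  have h2 : 0 ≤ ∫ x in a..b, p x := intervalIntegral.integral_nonneg hab
    fun x hx => H.nonneg x ⟨ha.trans hx.1, hx.2.trans hb⟩
  linarith

theorem mul_le_sub (ha : 0 ≤ a) (hab : a ≤ b) (hb : b ≤ 1) : (b - a) * p a ≤ f a - f b := by
  rw [← H.integral_slope ha hab hb]
  have := intervalIntegral.integral_mono_on hab (f := fun _ => p a) (by simp)
    (H.intervalIntegrable ha hab hb)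
    fun x hx => H.mono ⟨ha, hab.trans hb⟩ ⟨ha.trans hx.1, hx.2.trans hb⟩ hx.1
  simpa using this

/-- Concavity: decrements over intervals of the same length grow. -/
theorem sub_le_sub (ha : 0 ≤ a) (hab : a ≤ b) (hc : 0 ≤ c) (hb : b + c ≤ 1) :
    f a - f (a + c) ≤ f b - f (b + c) := by
  rw [← H.integral_slope ha (by linarith) (by linarith),
    ← H.integral_slope (ha.trans hab) (by linarith) hb]
  have e1 := intervalIntegral.integral_comp_add_right (a := 0) (b := c) p a
  have e2 := intervalIntegral.integral_comp_add_right (a := 0) (b := c) p b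
  have i : ∀ y, 0 ≤ y → y + c ≤ 1 → IntervalIntegrable (fun x => p (x + y)) volume 0 c := by
    intro y hy hyc
    refine ContinuousOn.intervalIntegrable ?_
    rw [uIcc_of_le hc]
    exact H.contp.comp (by fun_prop) fun x hx => ⟨by linarith [hx.1], by linarith [hx.2]⟩
  simp only [zero_add] at e1 e2
  rw [add_comm a c, add_comm b c, ← e1, ← e2]
  refine intervalIntegral.integral_mono_on hc (i a ha (by linarith)) (i b (by linarith) hb) ?_
  intro x hx
  exact H.mono ⟨by linarith [hx.1], by linarith [hx.2]⟩ ⟨by linarith [hx.1], by linarith [hx.2]⟩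
    (by linarith)

/-- Contracting an interval towards `1` decreases the decrement over it. -/
theorem sub_le_sub_of_contract (ha : 0 ≤ a) (hab : a ≤ b) (hb : b ≤ 1) (hc : 0 ≤ c) (hc1 : c ≤ 1) :
    f (1 - c * (1 - a)) - f (1 - c * (1 - b)) ≤ f a - f b := by
  have k1 : 0 ≤ 1 - c * (1 - a) := by nlinarith
  have k2 : 1 - c * (1 - a) ≤ 1 - c * (1 - b) := by nlinarith
  have k3 : 1 - c * (1 - b) ≤ 1 := by nlinarith
  rw [← H.integral_slope ha hab hb, ← H.integral_slope k1 k2 k3]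
  have e := intervalIntegral.smul_integral_comp_mul_add (a := a) (b := b) p c (1 - c)
  have e1 : c * a + (1 - c) = 1 - c * (1 - a) := by ring
  have e2 : c * b + (1 - c) = 1 - c * (1 - b) := by ring
  rw [e1, e2] at e
  rw [← e, smul_eq_mul, ← intervalIntegral.integral_const_mul]
  have hm : ∀ x ∈ Icc a b, c * x + (1 - c) ∈ Icc (0 : ℝ) 1 := by
    intro x hx
    constructor
    · nlinarith [hx.1, hx.2, mul_nonneg hc (ha.trans hx.1)]
    · nlinarith [hx.1, hx.2]
  refine intervalIntegral.integral_mono_on hab ?_ (H.intervalIntegrable ha hab hb) ?_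
  · refine ContinuousOn.intervalIntegrable ?_
    rw [uIcc_of_le hab]
    exact continuousOn_const.mul (H.contp.comp (by fun_prop) hm)
  · intro x hx
    have hx1 : x ≤ 1 := hx.2.trans hb
    have hx0 : 0 ≤ x := ha.trans hx.1
    rcases hx1.eq_or_lt with rfl | hlt
    · have : c * 1 + (1 - c) = 1 := by ring
      rw [this]
      nlinarith [H.nonneg 1 (by simp)]
    · have := H.anti ⟨hx0, hx1⟩ (hm x hx) (by nlinarith)
      simp only at this
      have e : (1 - (c * x + (1 - c))) = (1 - x) * c := by ring
      rw [e, mul_assoc] at this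
      exact le_of_mul_le_mul_left this (by linarith)

theorem reach_mem (hs1 : s ≤ 1) :
    reach f s ∈ Icc s 1 ∧ f s ≤ 1 + f (reach f s) := by
  have hne : {x | x ∈ Icc s 1 ∧ f s ≤ 1 + f x}.Nonempty := ⟨s, ⟨le_rfl, hs1⟩, by linarith⟩
  have hbd : BddAbove {x | x ∈ Icc s 1 ∧ f s ≤ 1 + f x} := ⟨1, fun x hx => hx.1.2⟩
  have hcl : IsClosed {x | x ∈ Icc s 1 ∧ f s ≤ 1 + f x} :=
    isClosed_Icc.inter (isClosed_le continuous_const (continuous_const.add H.contf))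
  exact hcl.csSup_mem hne hbd

theorem le_reach_iff (hs0 : 0 ≤ s) (hx : x ∈ Icc s 1) : f s ≤ 1 + f x ↔ x ≤ reach f s := by
  have hm := H.reach_mem (hx.1.trans hx.2)
  constructor
  · intro h
    exact le_csSup ⟨1, fun x hx => hx.1.2⟩ ⟨hx, h⟩
  · intro h
    have := H.antitone (hs0.trans hx.1) h hm.1.2
    linarith [hm.2]

/-- Below `1`, accepting the value `reach f s` and rejecting it are equally good. -/
theorem reach_eq_one_or (hs1 : s ≤ 1) :
    reach f s = 1 ∨ f s = 1 + f (reach f s) := by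
  by_contra! hcon
  have hm := H.reach_mem hs1
  have hlt : reach f s < 1 := lt_of_le_of_ne hm.1.2 hcon.1
  have hlt2 : f s < 1 + f (reach f s) := lt_of_le_of_ne hm.2 hcon.2
  have : ∀ᶠ y in 𝓝 (reach f s), f s < 1 + f y ∧ y < 1 :=
    ((continuous_const.add H.contf).continuousAt.eventually (lt_mem_nhds hlt2)).and
      (gt_mem_nhds hlt)
  obtain ⟨y, hy, hy2⟩ := ((this.filter_mono nhdsWithin_le_nhds).and
    (self_mem_nhdsWithin (s := Ioi (reach f s)))).exists
  have hle : y ≤ reach f s :=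
    le_csSup ⟨1, fun x hx => hx.1.2⟩ ⟨⟨hm.1.1.trans hy2.le, hy.2.le⟩, hy.1.le⟩
  exact absurd hy2 (not_lt.2 hle)

theorem reach_mono (hs : 0 ≤ s) (hst : s ≤ t) (ht : t ≤ 1) : reach f s ≤ reach f t := by
  have hm := H.reach_mem (hst.trans ht)
  have hmt := H.reach_mem ht
  rcases le_total (reach f s) t with h | h
  · exact h.trans hmt.1.1
  · rw [← H.le_reach_iff (hs.trans hst) ⟨h, hm.1.2⟩]
    linarith [hm.2, H.antitone hs hst ht]

/-- Concavity: the acceptance interval shrinks as the last accepted value grows. -/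
theorem reach_sub_anti (hs : 0 ≤ s) (hst : s ≤ t) (ht : t ≤ 1) :
    reach f t - t ≤ reach f s - s := by
  by_contra! hcon
  have hm := H.reach_mem (hst.trans ht)
  have hmt := H.reach_mem ht
  -- Shifting `reach f t` back by `t - s` gives a value that is not accepted at `s`.
  set y := reach f t - (t - s) with hy
  have hys : y ∈ Icc s 1 := ⟨by linarith [hmt.1.1], by linarith [hmt.1.2]⟩
  have h1 : ¬ f s ≤ 1 + f y := by
    rw [H.le_reach_iff hs hys]
    linarith
  have h2 := H.sub_le_sub (a := s) (b := y) (c := t - s) hs hys.1 (by linarith)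
    (by linarith [hmt.1.2])
  have e1 : s + (t - s) = t := by ring
  have e2 : y + (t - s) = reach f t := by rw [hy]; ring
  rw [e1, e2] at h2
  linarith [hmt.2]

/-- Relative to the distance to `1`, the acceptance interval grows with the last accepted value. -/
theorem reach_scale (hs : 0 ≤ s) (hst : s ≤ t) (ht : t ≤ 1) :
    (1 - t) * (reach f s - s) ≤ (1 - s) * (reach f t - t) := by
  rcases (hst.trans ht).eq_or_lt with rfl | hs1
  · have : t = 1 := le_antisymm ht hst
    subst this
    simp
  have hm := H.reach_mem hs1.le
  -- The homothety with centre `1` that maps `s` to `t` maps `reach f s` to an accepted value.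
  set c := (1 - t) / (1 - s) with hc
  have hs1' : 0 < 1 - s := by linarith
  have hcs : c * (1 - s) = 1 - t := div_mul_cancel₀ _ hs1'.ne'
  have hc0 : 0 ≤ c := div_nonneg (by linarith) hs1'.le
  have hc1 : c ≤ 1 := (div_le_one hs1').2 (by linarith)
  have h := H.sub_le_sub_of_contract hs hm.1.1 hm.1.2 hc0 hc1
  have e : 1 - c * (1 - s) = t := by rw [hcs]; ring
  rw [e] at h
  have hx : 1 - c * (1 - reach f s) ∈ Icc t 1 :=
    ⟨by nlinarith [hm.1.1], by nlinarith [hm.1.2]⟩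
  have h2 := (H.le_reach_iff (hs.trans hst) hx).1 (by linarith [hm.2])
  have h3 : (1 - s) * (1 - c * (1 - reach f s)) = (1 - s) - (1 - t) * (1 - reach f s) := by
    rw [← hcs]; ring
  nlinarith

theorem reach_mul_le (hs : 0 ≤ s) (hs1 : s ≤ 1) : (reach f s - s) * p s ≤ 1 := by
  have hm := H.reach_mem hs1
  linarith [H.mul_le_sub hs hm.1.1 hm.1.2, hm.2]

theorem continuousOn_reach : ContinuousOn (reach f) (Icc 0 1) := by
  have key : ∀ s ∈ Icc (0 : ℝ) 1, ∀ t ∈ Icc (0 : ℝ) 1, s ≤ t → |reach f t - reach f s| ≤ t - s := by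
    intro s hs t ht hst
    rw [abs_le]
    constructor
    · linarith [H.reach_mono hs.1 hst ht.2]
    · linarith [H.reach_sub_anti hs.1 hst ht.2]
  have : LipschitzOnWith 1 (reach f) (Icc 0 1) := by
    refine LipschitzOnWith.of_dist_le_mul fun s hs t ht => ?_
    rw [Real.dist_eq, Real.dist_eq, NNReal.coe_one, one_mul]
    rcases le_total s t with h | h
    · rw [abs_sub_comm, abs_sub_comm s t, abs_of_nonneg (sub_nonneg.2 h)]
      exact key s hs t ht h
    · rw [abs_of_nonneg (sub_nonneg.2 h)]
      exact key t ht s hs h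
  exact this.continuousOn

/-- No interval of accepted values yields more than the Bellman increment. For `c < t` the integral
is oriented, hence nonpositive. -/
theorem integral_le_gain (ht : t ≤ 1) (hc0 : 0 ≤ c) (hc : c ≤ 1) :
    ∫ x in t..c, (1 + f x - f t) ≤ gain f t := by
  have hcf := H.contf
  have h0 : 0 ≤ gain f t := intervalIntegral.integral_nonneg ht fun x _ => le_max_left _ _
  rcases le_total t c with h | h
  · calc ∫ x in t..c, (1 + f x - f t) ≤ ∫ x in t..c, max 0 (1 + f x - f t) :=
        intervalIntegral.integral_mono_on h
          (Continuous.intervalIntegrable (by fun_prop) _ _)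
          (Continuous.intervalIntegrable (by fun_prop) _ _) fun x _ => le_max_right _ _
      _ ≤ gain f t := by
        refine intervalIntegral.integral_mono_interval le_rfl h hc
          (Eventually.of_forall fun x => le_max_left _ _)
          (Continuous.intervalIntegrable (by fun_prop) _ _)
  · rw [intervalIntegral.integral_symm]
    have : 0 ≤ ∫ x in c..t, (1 + f x - f t) := intervalIntegral.integral_nonneg h fun x hx => by
      linarith [H.antitone (hc0.trans hx.1) hx.2 ht]
    linarith

theorem max_eq_of_le_reach (hs : 0 ≤ s) (hx : x ∈ Icc s 1) (h : x ≤ reach f s) :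
    max 0 (1 + f x - f s) = 1 + f x - f s :=
  max_eq_right (by linarith [(H.le_reach_iff hs hx).2 h])

/-- The Bellman increment is attained by accepting the values in `[s, reach f s]`. -/
theorem gain_eq (hs : 0 ≤ s) (hs1 : s ≤ 1) :
    gain f s = ∫ x in s..reach f s, (1 + f x - f s) := by
  have hm := H.reach_mem hs1
  have hcf := H.contf
  have hi : ∀ a b, IntervalIntegrable (fun x => max 0 (1 + f x - f s)) volume a b :=
    fun a b => Continuous.intervalIntegrable (by fun_prop) _ _
  rw [gain, ← intervalIntegral.integral_add_adjacent_intervals (hi s (reach f s)) (hi _ 1)]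
  have h2 : ∫ x in reach f s..1, max 0 (1 + f x - f s) = 0 := by
    rw [intervalIntegral.integral_of_le hm.1.2]
    refine setIntegral_eq_zero_of_forall_eq_zero fun x hx => ?_
    have := not_le.1 (mt (H.le_reach_iff hs ⟨hm.1.1.trans hx.1.le, hx.2⟩).1 (not_le.2 hx.1))
    exact max_eq_left (by linarith)
  rw [h2, add_zero]
  refine intervalIntegral.integral_congr fun x hx => ?_
  rw [uIcc_of_le hm.1.1] at hx
  exact H.max_eq_of_le_reach hs ⟨hx.1, hx.2.trans hm.1.2⟩ hx.2

end IsProfile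

/-! ### The Bellman recursion preserves profiles -/

namespace IsProfile

variable {f p : ℝ → ℝ} (H : IsProfile f p) {s t a b c x : ℝ}
include H

theorem sub_le_mul (ha : 0 ≤ a) (hab : a ≤ b) (hb : b ≤ 1) : f a - f b ≤ (b - a) * p b := by
  rw [← H.integral_slope ha hab hb]
  have := intervalIntegral.integral_mono_on hab (g := fun _ => p b)
    (H.intervalIntegrable ha hab hb) (by simp)
    fun x hx => H.mono ⟨ha.trans hx.1, hx.2.trans hb⟩ ⟨ha.trans hab, hb⟩ hx.2
  simpa using this

theorem integral_excess_eq (t c : ℝ) :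
    ∫ x in t..c, (1 + f x - f t) = (c - t) * (1 - f t) + ∫ x in t..c, f x := by
  have hcf := H.contf
  have : ∀ x, 1 + f x - f t = (1 - f t) + f x := fun x => by ring
  simp_rw [this]
  rw [intervalIntegral.integral_add (by simp) (hcf.intervalIntegrable _ _)]
  simp only [intervalIntegral.integral_const, smul_eq_mul]

/-- Envelope theorem: only the explicit dependence on `s` contributes to the derivative of the
optimal gain, not the dependence of the optimal interval on `s`. -/
theorem hasDerivAt_gain (hs : s ∈ Ioo (0 : ℝ) 1) :
    HasDerivAt (gain f) (-1 + (reach f s - s) * p s) s := by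
  have hcf := H.contf
  have hm := H.reach_mem hs.2.le
  -- `A t` is the gain at `t` with the acceptance threshold frozen at its value for `s`.
  set A : ℝ → ℝ := fun t => ∫ x in t..reach f s, (1 + f x - f t) with hA
  have hAd : HasDerivAt A (-1 + (reach f s - s) * p s) s := by
    have e : A = fun t => (reach f s - t) * (1 - f t) + ∫ x in t..reach f s, f x := by
      funext t
      exact H.integral_excess_eq t _
    rw [e]
    have d1 : HasDerivAt (fun t => ∫ x in t..reach f s, f x) (-f s) s :=
      intervalIntegral.integral_hasDerivAt_left (hcf.intervalIntegrable _ _)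
        (hcf.stronglyMeasurableAtFilter _ _) hcf.continuousAt
    have d2 : HasDerivAt (fun t => reach f s - t) (-1) s := by
      simpa using (hasDerivAt_id s).const_sub (reach f s)
    have d3 : HasDerivAt (fun t => 1 - f t) (p s) s := by
      simpa using (H.deriv s hs).const_sub 1
    exact ((d2.mul d3).add d1).congr_deriv (by ring)
  have hnear : ∀ᶠ t in 𝓝 s, t ∈ Ioo (0 : ℝ) 1 := Ioo_mem_nhds hs.1 hs.2
  -- Optimality at `t` and at `s` gives `0 ≤ gain f t - A t ≤ (reach f t - reach f s) (f s - f t)`.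
  have hdiff : HasDerivAt (fun t => gain f t - A t) 0 s := by
    rw [hasDerivAt_iff_isLittleO]
    have h0 : gain f s - A s = 0 := sub_eq_zero.2 (H.gain_eq hs.1.le hs.2.le)
    have ho : (fun t => (reach f t - reach f s) * (f s - f t)) =o[𝓝 s] fun t => t - s := by
      have o1 : (fun t => reach f t - reach f s) =o[𝓝 s] fun _ => (1 : ℝ) := by
        rw [Asymptotics.isLittleO_one_iff]
        have := (H.continuousOn_reach.continuousAt (Icc_mem_nhds hs.1 hs.2)).tendsto
        simpa using this.sub_const (reach f s)
      have o2 : (fun t => f s - f t) =O[𝓝 s] fun t => t - s := by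
        have := (H.deriv s hs).isBigO_sub
        refine this.neg_left.congr_left fun t => by ring
      simpa using o1.mul_isBigO o2
    refine Asymptotics.IsBigO.trans_isLittleO ?_ ho
    refine Asymptotics.IsBigO.of_bound 1 ?_
    filter_upwards [hnear] with t ht
    have hmt := H.reach_mem ht.2.le
    have l1 : A t ≤ gain f t :=
      H.integral_le_gain ht.2.le (hs.1.le.trans hm.1.1) hm.1.2
    have l2 := H.integral_le_gain (t := s) hs.2.le (ht.1.le.trans hmt.1.1) hmt.1.2
    have e1 := H.gain_eq ht.1.le ht.2.le
    have e2 := H.integral_excess_eq t (reach f t)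
    have e3 := H.integral_excess_eq s (reach f t)
    have e4 : A t = _ := H.integral_excess_eq t (reach f s)
    have e5 : A s = _ := H.integral_excess_eq s (reach f s)
    have i : ∀ a b, IntervalIntegrable f volume a b := hcf.intervalIntegrable
    have e7 := intervalIntegral.integral_add_adjacent_intervals (i t s) (i s (reach f t))
    have e8 := intervalIntegral.integral_add_adjacent_intervals (i t s) (i s (reach f s))
    rw [h0]
    simp only [sub_zero, smul_zero, one_mul, Real.norm_eq_abs]
    rw [abs_of_nonneg (sub_nonneg.2 l1)]
    refine le_trans ?_ (le_abs_self _)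
    nlinarith
  exact ((hdiff.add hAd).congr_deriv (zero_add _)).congr_of_eventuallyEq
    (Eventually.of_forall fun t => (sub_add_cancel (gain f t) (A t)).symm)

/-- The Bellman recursion preserves profiles: concavity because the acceptance interval shrinks as
`s` grows, and the monotonicity of `(1 - s) p s` because it does not shrink faster than `1 - s`. -/
theorem succ : IsProfile (fun s => f s + gain f s) (nextSlope f p) := by
  have hreach := H.continuousOn_reach
  have hl : ∀ s ∈ Icc (0 : ℝ) 1, 0 ≤ reach f s - s ∧ reach f s - s ≤ 1 := by
    intro s hs
    have := H.reach_mem hs.2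
    exact ⟨by linarith [this.1.1], by linarith [this.1.2, hs.1]⟩
  refine ⟨H.contf.add (continuous_gain H.contf), ?_, ?_, ?_, ?_, ?_, ?_⟩
  · exact continuousOn_const.add
      ((continuousOn_const.sub (hreach.sub continuousOn_id)).mul H.contp)
  · intro x hx
    exact ((H.deriv x hx).add (H.hasDerivAt_gain hx)).congr_deriv (by rw [nextSlope]; ring)
  · simp [gain, H.one]
  · intro x hx
    have := H.nonneg x hx
    have h1 := hl x hx
    simp only [nextSlope]
    nlinarith
  · intro s hs t ht hst
    simp only [nextSlope]
    have h1 := H.reach_sub_anti hs.1 hst ht.2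
    have h2 := H.mono hs ht hst
    have := mul_le_mul (a := 1 - (reach f s - s)) (b := 1 - (reach f t - t)) (by linarith) h2
      (H.nonneg s hs) (by linarith [(hl t ht).2])
    linarith
  · intro s hs t ht hst
    simp only [nextSlope]
    have h1 := H.reach_scale hs.1 hst ht.2
    have h2 := H.anti hs ht hst
    have h3 := H.reach_sub_anti hs.1 hst ht.2
    have h4 := H.reach_mul_le hs.1 hs.2
    have h5 := H.nonneg s hs
    have h6 := hl s hs
    simp only at h2
    have a1 : (1 - (reach f t - t)) * ((1 - t) * p t) ≤ (1 - (reach f t - t)) * ((1 - s) * p s) :=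
      mul_le_mul_of_nonneg_left h2 (by linarith [(hl t ht).2])
    have a2 : ((reach f s - s) - (reach f t - t)) * ((1 - s) * p s) ≤ t - s := by
      calc ((reach f s - s) - (reach f t - t)) * ((1 - s) * p s)
          = ((1 - s) * (reach f s - s) - (1 - s) * (reach f t - t)) * p s := by ring
        _ ≤ ((t - s) * (reach f s - s)) * p s := by
            refine mul_le_mul_of_nonneg_right ?_ h5
            linarith
        _ = (t - s) * ((reach f s - s) * p s) := by ring
        _ ≤ (t - s) * 1 := mul_le_mul_of_nonneg_left h4 (by linarith)
        _ = t - s := mul_one _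
    nlinarith

/-- The budget identity behind the lower bound on the slope: `1 - s` splits into the gain of the
next observation and the weighted slope over the acceptance interval. -/
theorem gain_add_integral (hs : 0 ≤ s) (hs1 : s ≤ 1) :
    gain f s + ∫ x in s..reach f s, (1 - x) * p x = 1 - s := by
  have hcf := H.contf
  have hm := H.reach_mem hs1
  set h := reach f s with hh
  have hpi := H.intervalIntegrable hs hm.1.1 hm.1.2
  have hpi2 : IntervalIntegrable (fun x => (1 - x) * p x) volume s h :=
    hpi.continuousOn_mul (by fun_prop)
  have hnf : IntervalIntegrable (fun x => -f x) volume s h :=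
    Continuous.intervalIntegrable (by fun_prop) _ _
  have hparts := intervalIntegral.integral_eq_sub_of_hasDerivAt_of_le
    (f := fun x => (1 - x) * f x) (f' := fun x => -f x - (1 - x) * p x) hm.1.1 (by fun_prop)
    (fun x hx => by
      have d1 : HasDerivAt (fun x : ℝ => 1 - x) (-1) x := by
        simpa using (hasDerivAt_id x).const_sub 1
      exact (d1.mul (H.deriv x ⟨hs.trans_lt hx.1, hx.2.trans_le hm.1.2⟩)).congr_deriv (by ring))
    (hnf.sub hpi2)
  rw [intervalIntegral.integral_sub hnf hpi2, intervalIntegral.integral_neg] at hparts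
  rw [H.gain_eq hs hs1, H.integral_excess_eq]
  -- Either the interval reaches `1`, or accepting its right end is a tie.
  have h0 : (1 - h) * (1 - f s + f h) = 0 := by
    rcases H.reach_eq_one_or hs1 with h1 | h1
    · rw [← hh] at h1
      rw [h1]; ring
    · rw [← hh] at h1
      rw [h1]; ring
  nlinarith

/-- The gain controls the error of the tangent approximation `1 / p s` to the length of the
acceptance interval. -/
theorem mul_one_sub_le_gain (hs : 0 ≤ s) (hs1 : s ≤ 1) :
    (1 - s) * (1 - (reach f s - s) * p s) ≤ gain f s := by
  have hm := H.reach_mem hs1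
  have hpi2 : IntervalIntegrable (fun x => (1 - x) * p x) volume s (reach f s) :=
    (H.intervalIntegrable hs hm.1.1 hm.1.2).continuousOn_mul (by fun_prop)
  have h := H.gain_add_integral hs hs1
  have := intervalIntegral.integral_mono_on hm.1.1 (g := fun _ => (1 - s) * p s) hpi2 (by simp)
    fun x hx => H.anti ⟨hs, hs1⟩ ⟨hs.trans hx.1, hx.2.trans hm.1.2⟩ hx.1
  simp only [intervalIntegral.integral_const, smul_eq_mul] at this
  nlinarith

end IsProfile

/-! ### Estimates for one observation -/

theorem isProfile_unifValue (k : ℕ) : IsProfile (unifValue k) (slope k) := by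
  induction k with
  | zero =>
    refine ⟨continuous_const, continuousOn_const, fun x _ => ?_, rfl, fun x _ => le_rfl,
      fun _ _ _ _ _ => le_rfl, fun _ _ _ _ _ => ?_⟩
    · simpa [unifValue, slope] using hasDerivAt_const x (0 : ℝ)
    · simp [slope]
  | succ k ih => exact ih.succ

theorem one_le_slope (k : ℕ) {s : ℝ} (hs : 0 ≤ s) (hs1 : s ≤ 1) : 1 ≤ slope (k + 1) s := by
  have H := isProfile_unifValue k
  have h1 := (H.reach_mem hs1).1.2
  have h2 := H.nonneg s ⟨hs, hs1⟩
  simp only [slope, nextSlope]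
  nlinarith

/-- The acceptance interval that is optimal with one more observation to come is still admissible
with one fewer. -/
theorem gain_unifValue_succ_le (k : ℕ) {s : ℝ} (hs : 0 ≤ s) (hs1 : s ≤ 1) :
    gain (unifValue (k + 1)) s ≤
      (1 - (reach (unifValue (k + 1)) s - s)) * gain (unifValue k) s +
        ∫ x in s..reach (unifValue (k + 1)) s, gain (unifValue k) x := by
  have H := isProfile_unifValue k
  have H' := isProfile_unifValue (k + 1)
  have hm := H'.reach_mem hs1
  set h := reach (unifValue (k + 1)) s
  have hc := continuous_unifValue k
  have hg := continuous_gain hc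
  have e1 := H'.gain_eq hs hs1
  have e2 := H'.integral_excess_eq s h
  have e3 := H.integral_excess_eq s h
  have e4 := H.integral_le_gain hs1 (hs.trans hm.1.1) hm.1.2
  have e5 : ∫ x in s..h, unifValue (k + 1) x =
      (∫ x in s..h, unifValue k x) + ∫ x in s..h, gain (unifValue k) x :=
    intervalIntegral.integral_add (hc.intervalIntegrable _ _) (hg.intervalIntegrable _ _)
  have e6 : unifValue (k + 1) s = unifValue k s + gain (unifValue k) s := rfl
  rw [e1, e2, e5, e6]
  nlinarith

/-- The slope at `s` dominates `k / (1 - s)` times the value of a `k`-th observation: raising the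
last accepted value from `s` to `s + ds` removes each of the `k` usable observations with
probability `ds / (1 - s)`. -/
theorem succ_mul_gain_le_slope (k : ℕ) :
    ∀ s : ℝ, 0 ≤ s → s ≤ 1 → (k + 1) * gain (unifValue k) s ≤ (1 - s) * slope (k + 1) s := by
  induction k with
  | zero =>
    intro s hs hs1
    simp [gain, unifValue, slope, nextSlope]
  | succ k ih =>
    intro s hs hs1
    have H := isProfile_unifValue (k + 1)
    have hm := H.reach_mem hs1
    have e1 := H.gain_add_integral hs hs1
    have e2 := gain_unifValue_succ_le k hs hs1
    have e3 := ih s hs hs1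
    have e4 : (k + 1 : ℝ) * ∫ x in s..reach (unifValue (k + 1)) s, gain (unifValue k) x ≤
        ∫ x in s..reach (unifValue (k + 1)) s, (1 - x) * slope (k + 1) x := by
      rw [← intervalIntegral.integral_const_mul]
      refine intervalIntegral.integral_mono_on hm.1.1 ?_
        ((H.intervalIntegrable hs hm.1.1 hm.1.2).continuousOn_mul (by fun_prop)) ?_
      · exact (continuous_const.mul (continuous_gain (continuous_unifValue k))).intervalIntegrable
          _ _
      · exact fun x hx => ih x (hs.trans hx.1) (hx.2.trans hm.1.2)
    have e5 : slope (k + 1 + 1) s =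
      1 + (1 - (reach (unifValue (k + 1)) s - s)) * slope (k + 1) s := rfl
    rw [e5]
    push_cast
    set l := reach (unifValue (k + 1)) s - s with hl
    have hl1 : 0 ≤ 1 - l := by rw [hl]; linarith [hm.1.2]
    have e6 := mul_le_mul_of_nonneg_left e3 hl1
    have e7 := mul_le_mul_of_nonneg_left e2 (by positivity : (0 : ℝ) ≤ k + 1)
    nlinarith

/-- In terms of the length `ℓ` of the acceptance interval, `1 / p - ℓ ≤ 1 / (k + 1)`. -/
theorem succ_mul_le_slope (k : ℕ) {s : ℝ} (hs : 0 ≤ s) (hs1 : s < 1) :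
    (k + 1) * (1 - (reach (unifValue (k + 1)) s - s) * slope (k + 1) s) ≤ slope (k + 1) s := by
  have H := isProfile_unifValue (k + 1)
  have h1 := H.mul_one_sub_le_gain hs hs1.le
  have h2 := succ_mul_gain_le_slope (k + 1) s hs hs1.le
  have e5 : slope (k + 1 + 1) s =
      1 + (1 - (reach (unifValue (k + 1)) s - s)) * slope (k + 1) s := rfl
  rw [e5] at h2
  push_cast at h2
  have h3 := mul_le_mul_of_nonneg_left h1 (by positivity : (0 : ℝ) ≤ k + 1 + 1)
  refine le_of_mul_le_mul_left ?_ (by linarith : 0 < 1 - s)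
  nlinarith

theorem integral_sq_line (s h q : ℝ) :
    3 * q * ∫ x in s..h, (1 - q * (x - s)) ^ 2 = 1 - (1 - q * (h - s)) ^ 3 := by
  have := intervalIntegral.integral_eq_sub_of_hasDerivAt (a := s) (b := h)
    (f := fun x => -(1 - q * (x - s)) ^ 3) (f' := fun x => 3 * q * (1 - q * (x - s)) ^ 2)
    (fun x _ => by
      have d1 : HasDerivAt (fun x : ℝ => 1 - q * (x - s)) (-q) x := by
        simpa using (((hasDerivAt_id x).sub_const s).const_mul q).const_sub 1
      exact (d1.pow 3).neg.congr_deriv (by push_cast; ring))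
    (Continuous.intervalIntegrable (by fun_prop) _ _)
  rw [intervalIntegral.integral_const_mul] at this
  rw [this]
  simp
  ring

/-- Concavity keeps the excess above the chord, whose squared integral is a third of the length of
the acceptance interval. -/
theorem IsProfile.le_integral_sq {f p : ℝ → ℝ} (H : IsProfile f p) {s : ℝ} (hs : 0 ≤ s)
    (hs1 : s ≤ 1) :
    (reach f s - s) / 3 ≤ ∫ x in s..reach f s, (1 + f x - f s) ^ 2 := by
  have hcf := H.contf
  have hm := H.reach_mem hs1
  set h := reach f s
  rcases hm.1.1.eq_or_lt with heq | hlt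
  · rw [← heq]; simp
  have hl : 0 < h - s := sub_pos.2 hlt
  have h1 := integral_sq_line s h (h - s)⁻¹
  rw [inv_mul_cancel₀ hl.ne'] at h1
  have h2 : ∫ x in s..h, (1 - (h - s)⁻¹ * (x - s)) ^ 2 = (h - s) / 3 := by
    field_simp at h1 ⊢
    linarith
  rw [← h2]
  refine intervalIntegral.integral_mono_on hm.1.1
    (Continuous.intervalIntegrable (by fun_prop) _ _)
    (Continuous.intervalIntegrable (by fun_prop) _ _) fun x hx => ?_
  have hx0 : 0 ≤ x := hs.trans hx.1
  have c1 := H.sub_le_mul hs hx.1 (hx.2.trans hm.1.2)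
  have c2 := H.mul_le_sub hx0 hx.2 hm.1.2
  have c3 := mul_le_mul_of_nonneg_left c1 (sub_nonneg.2 hx.2)
  have c4 := mul_le_mul_of_nonneg_left c2 (sub_nonneg.2 hx.1)
  have c5 : (h - s) * (f s - f x) ≤ (x - s) * 1 := by
    have := mul_le_mul_of_nonneg_left (a := x - s) (by linarith [hm.2] : f s - f h ≤ 1)
      (sub_nonneg.2 hx.1)
    nlinarith
  have c6 : f s - f x ≤ (h - s)⁻¹ * (x - s) := by
    rw [inv_mul_eq_div, le_div_iff₀ hl]
    linarith
  have c7 : (h - s)⁻¹ * (x - s) ≤ 1 := by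
    rw [inv_mul_eq_div, div_le_one hl]
    linarith [hx.2]
  exact pow_le_pow_left₀ (by linarith) (by linarith) 2

/-- The tangent at `s` bounds the excess from above, and the acceptance interval is almost as long
as the one that the tangent would give. -/
theorem integral_sq_le (k : ℕ) {s : ℝ} (hs : 0 ≤ s) (hs1 : s ≤ 1) :
    ∫ x in s..reach (unifValue k) s, (1 + unifValue k x - unifValue k s) ^ 2 ≤
      (reach (unifValue k) s - s) / 3 + 2 / 3 * (1 / (k + 1)) := by
  have H := isProfile_unifValue k
  have hcf := H.contf
  have hm := H.reach_mem hs1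
  rcases k with _ | k
  · generalize reach (unifValue 0) s = h at hm ⊢
    simp [unifValue]
    linarith [hm.1.2]
  rcases hs1.eq_or_lt with rfl | hlt
  · have : reach (unifValue (k + 1)) 1 = 1 := le_antisymm hm.1.2 hm.1.1
    rw [this]
    simp
    positivity
  have hp := one_le_slope k hs hs1
  have hk := succ_mul_le_slope k hs hlt
  have hpl := H.reach_mul_le hs hs1
  set f := unifValue (k + 1)
  set h := reach f s
  set p := slope (k + 1) s with hpdef
  have hp0 : 0 < p := by linarith
  have h1 := integral_sq_line s h p
  have h2 : ∫ x in s..h, (1 + f x - f s) ^ 2 ≤ ∫ x in s..h, (1 - p * (x - s)) ^ 2 := by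
    refine intervalIntegral.integral_mono_on hm.1.1
      (Continuous.intervalIntegrable (by fun_prop) _ _)
      (Continuous.intervalIntegrable (by fun_prop) _ _) fun x hx => ?_
    have c1 := H.mul_le_sub hs hx.1 (hx.2.trans hm.1.2)
    have c2 := (H.le_reach_iff hs ⟨hx.1, hx.2.trans hm.1.2⟩).2 hx.2
    rw [← hpdef] at c1
    exact pow_le_pow_left₀ (by linarith) (by linarith) 2
  have h3 : 3 * p * ∫ x in s..h, (1 - p * (x - s)) ^ 2 ≤ 1 := by
    rw [h1]
    have : 0 ≤ (1 - p * (h - s)) ^ 3 := pow_nonneg (by linarith) 3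
    linarith
  have h4 : ∫ x in s..h, (1 - p * (x - s)) ^ 2 ≤ (h - s) / 3 + 1 / 3 * (1 / (k + 1)) := by
    refine le_of_mul_le_mul_left (h3.trans ?_) (by positivity : 0 < 3 * p)
    -- This is `succ_mul_le_slope` after clearing denominators.
    field_simp
    nlinarith
  refine h2.trans (h4.trans ?_)
  have : 1 / 3 * (1 / ((k : ℝ) + 1)) ≤ 2 / 3 * (1 / (((k + 1 : ℕ) : ℝ) + 1)) := by
    push_cast
    rw [div_mul_div_comm, div_mul_div_comm, div_le_div_iff₀ (by positivity) (by positivity)]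
    have : (0 : ℝ) ≤ k := k.cast_nonneg
    linarith
  linarith

theorem gain_nonneg (f : ℝ → ℝ) {s : ℝ} (hs1 : s ≤ 1) : 0 ≤ gain f s :=
  intervalIntegral.integral_nonneg hs1 fun _ _ => le_max_left _ _

theorem IsProfile.gain_le {f p : ℝ → ℝ} (H : IsProfile f p) {s : ℝ} (hs : 0 ≤ s)
    (hs1 : s ≤ 1) : gain f s ≤ reach f s - s := by
  have hcf := H.contf
  have hm := H.reach_mem hs1
  rw [H.gain_eq hs hs1]
  have := intervalIntegral.integral_mono_on (f := fun x => 1 + f x - f s) (g := fun _ => (1 : ℝ))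
    (μ := volume) hm.1.1 (Continuous.intervalIntegrable (by fun_prop) _ _)
    intervalIntegrable_const fun x hx => by
      linarith [H.antitone hs hx.1 (hx.2.trans hm.1.2)]
  simpa using this

theorem unifValue_mem (k : ℕ) {s : ℝ} (hs : 0 ≤ s) (hs1 : s ≤ 1) :
    unifValue k s ∈ Icc (0 : ℝ) k := by
  induction k with
  | zero => simp [unifValue]
  | succ k ih =>
    have H := isProfile_unifValue k
    have h1 := gain_nonneg (unifValue k) hs1
    have h2 := H.gain_le hs hs1
    have h3 := (H.reach_mem hs1).1.2
    simp only [unifValue, mem_Icc] at ih ⊢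
    push_cast
    exact ⟨by linarith, by linarith⟩

/-- At most one value is tied between acceptance and rejection. -/
theorem subsingleton_tie (k : ℕ) {s : ℝ} (hs : 0 ≤ s) :
    {x | x ∈ Icc s 1 ∧ 1 + unifValue k x - unifValue k s = 0}.Subsingleton := by
  rcases k with _ | k
  · intro x hx
    have := hx.2
    simp [unifValue] at this
  have H := isProfile_unifValue (k + 1)
  have key : ∀ x ∈ {x | x ∈ Icc s 1 ∧ 1 + unifValue (k + 1) x - unifValue (k + 1) s = 0},
      ∀ y ∈ {x | x ∈ Icc s 1 ∧ 1 + unifValue (k + 1) x - unifValue (k + 1) s = 0}, ¬ x < y := by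
    intro x hx y hy hxy
    have h1 := H.mul_le_sub (hs.trans hx.1.1) hxy.le hy.1.2
    have h2 := one_le_slope k (hs.trans hx.1.1) hx.1.2
    have h3 := hx.2
    have h4 := hy.2
    nlinarith
  intro x hx y hy
  exact le_antisymm (not_lt.1 (key y hy x hx)) (not_lt.1 (key x hx y hy))

/-! ### Reduction to uniform observations -/

section Law

theorem cdf_mem_Icc (F : Measure ℝ) (x : ℝ) : cdf F x ∈ Icc (0 : ℝ) 1 :=
  ⟨cdf_nonneg F x, cdf_le_one F x⟩

variable (F : Measure ℝ) [IsProbabilityMeasure F]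

/-- Probability integral transform. -/
theorem map_cdf_eq (hF : Continuous (fun x => cdf F x)) :
    F.map (fun x => cdf F x) = volume.restrict (Icc 0 1) := by
  have hm : Measurable (fun x => cdf F x) := hF.measurable
  have : IsProbabilityMeasure (F.map (fun x => cdf F x)) :=
    Measure.isProbabilityMeasure_map hm.aemeasurable
  refine Measure.ext_of_Iic _ _ fun a => ?_
  rw [Measure.map_apply hm measurableSet_Iic, Measure.restrict_apply measurableSet_Iic]
  rcases lt_or_ge a 0 with ha | ha
  · have h1 : (fun x => cdf F x) ⁻¹' Iic a = ∅ := by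
      ext x
      simpa using ha.trans_le (cdf_nonneg F x)
    have h2 : Iic a ∩ Icc (0 : ℝ) 1 = ∅ := by
      ext x
      simp only [mem_inter_iff, mem_Iic, mem_Icc, mem_empty_iff_false, iff_false]
      intro h
      linarith [h.1, h.2.1]
    rw [h1, h2, measure_empty, measure_empty]
  rcases le_or_gt 1 a with ha1 | ha1
  · have h1 : (fun x => cdf F x) ⁻¹' Iic a = univ := by
      ext x
      simpa using (cdf_le_one F x).trans ha1
    have h2 : Iic a ∩ Icc (0 : ℝ) 1 = Icc 0 1 :=
      inter_eq_right.2 fun x hx => hx.2.trans ha1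
    rw [h1, h2, measure_univ, Real.volume_Icc]
    simp
  have h2 : Iic a ∩ Icc (0 : ℝ) 1 = Icc 0 a := by
    ext x
    simp only [mem_inter_iff, mem_Iic, mem_Icc]
    constructor
    · exact fun h => ⟨h.2.1, h.1⟩
    · exact fun h => ⟨h.2, h.1, h.2.trans ha1.le⟩
  rw [h2, Real.volume_Icc, sub_zero]
  set A := (fun x => cdf F x) ⁻¹' Iic a with hA
  rcases A.eq_empty_or_nonempty with he | hne
  · have ha0 : a = 0 := by
      by_contra hcon
      have hpos : 0 < a := lt_of_le_of_ne ha (Ne.symm hcon)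
      obtain ⟨x, hx⟩ := ((tendsto_cdf_atBot F).eventually (gt_mem_nhds hpos)).exists
      have : x ∈ A := hx.le
      simp [he] at this
    rw [he, ha0]
    simp
  · obtain ⟨y, hy⟩ := ((tendsto_cdf_atTop F).eventually (lt_mem_nhds ha1)).exists
    have hub : ∀ x ∈ A, x ≤ y := by
      intro x hx
      by_contra! hcon
      have := monotone_cdf F hcon.le
      exact absurd (this.trans hx) (not_le.2 hy)
    have hcl : IsClosed A := isClosed_Iic.preimage hF
    have hb : sSup A ∈ A := hcl.csSup_mem hne ⟨y, hub⟩
    have hAeq : A = Iic (sSup A) := by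
      ext x
      constructor
      · exact fun hx => le_csSup ⟨y, hub⟩ hx
      · exact fun hx => (monotone_cdf F hx).trans hb
    have hval : cdf F (sSup A) = a := by
      refine le_antisymm hb ?_
      by_contra! hcon
      have hev : ∀ᶠ x in 𝓝[>] (sSup A), cdf F x < a :=
        (hF.continuousAt.eventually (gt_mem_nhds hcon)).filter_mono nhdsWithin_le_nhds
      obtain ⟨x, hx, hx2⟩ := (hev.and self_mem_nhdsWithin).exists
      exact absurd (le_csSup ⟨y, hub⟩ (show x ∈ A from hx.le)) (not_le.2 hx2)
    rw [hAeq, ← ofReal_cdf, hval]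

theorem cdf_zero_eq (hF : Continuous (fun x => cdf F x)) (h0 : F (Iio 0) = 0) : cdf F 0 = 0 := by
  have h1 : Tendsto (fun x => cdf F x) (𝓝[<] 0) (𝓝 (cdf F 0)) :=
    hF.continuousAt.tendsto.mono_left nhdsWithin_le_nhds
  refine tendsto_nhds_unique h1 (tendsto_const_nhds.congr' ?_)
  filter_upwards [self_mem_nhdsWithin] with x hx
  have : F (Iic x) = 0 := measure_mono_null (Iic_subset_Iio.2 hx) h0
  rw [cdf_eq_real, measureReal_def, this]
  rfl

theorem setIntegral_Ioi_comp_cdf (hF : Continuous (fun x => cdf F x)) (s : ℝ) {φ : ℝ → ℝ}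
    (hφ : Continuous φ) :
    ∫ x in Ioi s, φ (cdf F x) ∂F = ∫ y in (cdf F s)..1, φ y := by
  have hmap := map_cdf_eq F hF
  have hnull : F ((fun x => cdf F x) ⁻¹' {cdf F s}) = 0 := by
    rw [← Measure.map_apply hF.measurable (measurableSet_singleton _), hmap]
    exact le_antisymm ((Measure.restrict_apply_le _ _).trans (by simp)) bot_le
  have hae : Ioi s =ᵐ[F] (fun x => cdf F x) ⁻¹' Ioi (cdf F s) := by
    refine Filter.eventuallyEq_set.2 ?_
    filter_upwards [compl_mem_ae_iff.2 hnull] with x hx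
    simp only [mem_Ioi, mem_preimage]
    constructor
    · intro h
      exact lt_of_le_of_ne (monotone_cdf F h.le) fun h' => hx h'.symm
    · intro h
      by_contra! hcon
      exact absurd (monotone_cdf F hcon) (not_le.2 h)
  rw [setIntegral_congr_set hae, ← setIntegral_map measurableSet_Ioi
    (hφ.aestronglyMeasurable) hF.measurable.aemeasurable, hmap,
    Measure.restrict_restrict measurableSet_Ioi, intervalIntegral.integral_of_le (cdf_le_one F s)]
  congr 2
  ext y
  simp only [mem_inter_iff, mem_Ioi, mem_Icc, mem_Ioc]
  constructor
  · exact fun h => ⟨h.1, h.2.2⟩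
  · exact fun h => ⟨h.1, (cdf_nonneg F s).trans h.1.le, h.2⟩

/-- On the scale of the distribution function, the observations are uniform. -/
theorem value_eq (hF : Continuous (fun x => cdf F x)) (k : ℕ) (s : ℝ) :
    value F k s = unifValue k (cdf F s) := by
  induction k generalizing s with
  | zero => rfl
  | succ k ih =>
    have hc := continuous_unifValue k
    simp only [value, unifValue, ih]
    rw [setIntegral_Ioi_comp_cdf F hF s
      (φ := fun y => max (unifValue k (cdf F s)) (1 + unifValue k y)) (by fun_prop), gain]
    have : ∀ y, max (unifValue k (cdf F s)) (1 + unifValue k y) =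
        unifValue k (cdf F s) + max 0 (1 + unifValue k y - unifValue k (cdf F s)) := by
      intro y
      rw [← max_add_add_left]
      congr 1 <;> ring
    simp_rw [this]
    rw [intervalIntegral.integral_add (by simp) (Continuous.intervalIntegrable (by fun_prop) _ _)]
    simp only [intervalIntegral.integral_const, smul_eq_mul]
    ring

theorem le_threshold (hF : Continuous (fun x => cdf F x)) (k : ℕ) {s x : ℝ} (hsx : s ≤ x)
    (hx : cdf F x < 1)
    (h : unifValue k (cdf F s) ≤ 1 + unifValue k (cdf F x)) :
    (x : EReal) ≤ threshold F (k + 1) s := by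
  refine le_sSup ⟨x, ⟨hsx, hx, ?_⟩, rfl⟩
  simpa [value_eq F hF] using h

theorem le_one_add_of_le_threshold (hF : Continuous (fun x => cdf F x)) (k : ℕ) {s x : ℝ}
    (h : (x : EReal) ≤ threshold F (k + 1) s) :
    unifValue k (cdf F s) ≤ 1 + unifValue k (cdf F x) := by
  by_contra! hcon
  have hcu := continuous_unifValue k
  have hev : ∀ᶠ y in 𝓝[<] x, 1 + unifValue k (cdf F y) < unifValue k (cdf F s) :=
    ((continuous_const.add (hcu.comp hF)).continuousAt.eventually
      (gt_mem_nhds hcon)).filter_mono nhdsWithin_le_nhds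
  obtain ⟨y, hy, hyx⟩ := (hev.and self_mem_nhdsWithin).exists
  have hle : threshold F (k + 1) s ≤ (y : EReal) := by
    refine sSup_le ?_
    rintro _ ⟨z, ⟨_, _, hz⟩, rfl⟩
    rw [EReal.coe_le_coe_iff]
    by_contra! hyz
    simp only [Nat.add_sub_cancel, value_eq F hF] at hz
    have := (isProfile_unifValue k).antitone (cdf_nonneg F y) (monotone_cdf F hyz.le)
      (cdf_le_one F z)
    linarith
  exact absurd (EReal.coe_le_coe_iff.1 (h.trans hle)) (not_le.2 hyx)

/-- The threshold is `⊥` where the distribution function equals `1` and monotone elsewhere. -/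
theorem measurable_threshold (hF : Continuous (fun x => cdf F x)) (k : ℕ) :
    Measurable (threshold F (k + 1)) := by
  classical
  have hmono : Monotone fun s => if cdf F s < 1 then threshold F (k + 1) s else ⊤ := by
    intro s t hst
    dsimp only
    by_cases ht : cdf F t < 1
    · have hs : cdf F s < 1 := (monotone_cdf F hst).trans_lt ht
      rw [if_pos ht, if_pos hs]
      refine sSup_le ?_
      rintro _ ⟨z, ⟨_, hz1, hz⟩, rfl⟩
      simp only [Nat.add_sub_cancel, value_eq F hF] at hz
      rcases le_total t z with htz | hzt
      · refine le_threshold F hF k htz hz1 (le_trans ?_ hz)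
        exact (isProfile_unifValue k).antitone (cdf_nonneg F s) (monotone_cdf F hst)
          (cdf_le_one F t)
      · exact (EReal.coe_le_coe_iff.2 hzt).trans (le_threshold F hF k le_rfl ht (by linarith))
    · rw [if_neg ht]
      exact le_top
  have heq : threshold F (k + 1) = fun s => if cdf F s < 1 then
      (if cdf F s < 1 then threshold F (k + 1) s else ⊤) else ⊥ := by
    funext s
    by_cases hs : cdf F s < 1
    · simp [hs]
    · rw [if_neg hs, threshold, sSup_eq_bot]
      rintro _ ⟨z, ⟨hsz, hz1, _⟩, rfl⟩
      exact absurd ((monotone_cdf F hsz).trans_lt hz1) hs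
  rw [heq]
  exact Measurable.ite (measurableSet_lt hF.measurable measurable_const) hmono.measurable
    measurable_const

end Law

/-! ### The optimal transition and the freezing lemma -/

/-- The pairs (observation, last accepted value), on the uniform scale, for which accepting is
feasible and at least as good as rejecting when `k` further observations are to come. -/
def acceptSet (k : ℕ) : Set (ℝ × ℝ) :=
  {q | q.2 ≤ q.1 ∧ unifValue k q.2 ≤ 1 + unifValue k q.1}

open scoped Classical in
/-- The martingale difference of `L_i + v_{n-i}(M_i)` under the optimal rule, as a function of the
observation and the last accepted value, when `k` further observations are to come. -/
def increment (k : ℕ) (q : ℝ × ℝ) : ℝ :=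
  (if q ∈ acceptSet k then 1 + unifValue k q.1 - unifValue k q.2 else 0) - gain (unifValue k) q.2

open scoped Classical in
/-- The last accepted value after an observation is treated by the optimal rule. -/
def nextValue (k : ℕ) (q : ℝ × ℝ) : ℝ := if q ∈ acceptSet k then q.1 else q.2

theorem measurableSet_acceptSet (k : ℕ) : MeasurableSet (acceptSet k) := by
  have hc := (continuous_unifValue k).measurable
  exact (measurableSet_le measurable_snd measurable_fst).inter
    (measurableSet_le (hc.comp measurable_snd) (measurable_const.add (hc.comp measurable_fst)))

theorem measurable_increment (k : ℕ) : Measurable (increment k) := by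
  have := continuous_unifValue k
  have := continuous_gain this
  exact (Measurable.ite (measurableSet_acceptSet k) (by fun_prop) measurable_const).sub
    (by fun_prop)

theorem measurable_nextValue (k : ℕ) : Measurable (nextValue k) :=
  Measurable.ite (measurableSet_acceptSet k) measurable_fst measurable_snd

section Kernel

variable (k : ℕ) {z : ℝ}

open scoped Classical in
theorem integral_ite_acceptSet (hz : z ∈ Icc (0 : ℝ) 1) {φ : ℝ → ℝ} (hφ : Continuous φ) (c : ℝ) :
    ∫ x in Icc (0 : ℝ) 1, (if (x, z) ∈ acceptSet k then φ x else c) =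
      (∫ x in z..reach (unifValue k) z, φ x) + (1 - (reach (unifValue k) z - z)) * c := by
  have H := isProfile_unifValue k
  have hm := H.reach_mem hz.2
  set h := reach (unifValue k) z
  have hsub : Icc z h ⊆ Icc 0 1 := Icc_subset_Icc hz.1 hm.1.2
  have hφi : IntegrableOn (fun x => φ x - c) (Icc z h) :=
    (hφ.sub continuous_const).continuousOn.integrableOn_Icc
  have e : ∀ x ∈ Icc (0 : ℝ) 1, (if (x, z) ∈ acceptSet k then φ x else c) =
      (Icc z h).indicator (fun x => φ x - c) x + c := by
    intro x hx
    have hiff : (x, z) ∈ acceptSet k ↔ x ∈ Icc z h := by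
      constructor
      · exact fun hq => ⟨hq.1, (H.le_reach_iff hz.1 ⟨hq.1, hx.2⟩).1 hq.2⟩
      · exact fun hq => ⟨hq.1, (H.le_reach_iff hz.1 ⟨hq.1, hx.2⟩).2 hq.2⟩
    by_cases hq : x ∈ Icc z h
    · rw [if_pos (hiff.2 hq), indicator_of_mem hq]
      ring
    · rw [if_neg (mt hiff.1 hq), indicator_of_notMem hq, zero_add]
  rw [setIntegral_congr_fun measurableSet_Icc e, integral_add, setIntegral_indicator
    measurableSet_Icc, inter_eq_self_of_subset_right hsub, integral_Icc_eq_integral_Ioc,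
    ← intervalIntegral.integral_of_le hm.1.1,
    intervalIntegral.integral_sub (hφ.intervalIntegrable _ _) (by simp)]
  · simp
    ring
  · rw [integrable_indicator_iff measurableSet_Icc, IntegrableOn,
      Measure.restrict_restrict measurableSet_Icc, inter_eq_self_of_subset_left hsub]
    exact hφi
  · exact integrable_const _

theorem integral_increment (hz : z ∈ Icc (0 : ℝ) 1) :
    ∫ x in Icc (0 : ℝ) 1, increment k (x, z) = 0 := by
  classical
  have hc := continuous_unifValue k
  have e : ∀ x, increment k (x, z) =
      if (x, z) ∈ acceptSet k then 1 + unifValue k x - unifValue k z - gain (unifValue k) z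
        else -gain (unifValue k) z := by
    intro x
    by_cases hq : (x, z) ∈ acceptSet k <;> simp [increment, hq]
  simp_rw [e]
  rw [integral_ite_acceptSet k hz (by fun_prop), intervalIntegral.integral_sub
    (Continuous.intervalIntegrable (by fun_prop) _ _) (by simp),
    ← (isProfile_unifValue k).gain_eq hz.1 hz.2]
  simp
  ring

theorem integral_excess_quadratic (hz : z ∈ Icc (0 : ℝ) 1) (a b c : ℝ) :
    ∫ x in z..reach (unifValue k) z, ((1 + unifValue k x - unifValue k z) ^ 2
        + a * (1 + unifValue k x - unifValue k z) + (b * (x - z) + c)) =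
      (∫ x in z..reach (unifValue k) z, (1 + unifValue k x - unifValue k z) ^ 2)
        + a * gain (unifValue k) z + (b * (reach (unifValue k) z - z) ^ 2 / 2
        + c * (reach (unifValue k) z - z)) := by
  have hc := continuous_unifValue k
  have i : ∀ {φ : ℝ → ℝ}, Continuous φ → IntervalIntegrable φ volume z (reach (unifValue k) z) :=
    fun h => h.intervalIntegrable _ _
  have e : ∫ x in z..reach (unifValue k) z, (x - z) = (reach (unifValue k) z - z) ^ 2 / 2 := by
    rw [intervalIntegral.integral_sub (i (φ := fun x => x) (by fun_prop))
      intervalIntegrable_const, integral_id, intervalIntegral.integral_const, smul_eq_mul]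
    ring
  rw [intervalIntegral.integral_add (i (by fun_prop)) (i (by fun_prop)),
    intervalIntegral.integral_add (i (by fun_prop)) (i (by fun_prop)),
    intervalIntegral.integral_const_mul,
    intervalIntegral.integral_add (i (by fun_prop)) (i (by fun_prop)),
    intervalIntegral.integral_const_mul, e,
    ← (isProfile_unifValue k).gain_eq hz.1 hz.2]
  simp
  ring

/-- The one-step identity for the second moment, with a free multiple `b` of the position. -/
theorem integral_increment_sq_add (hz : z ∈ Icc (0 : ℝ) 1) (b : ℝ) :
    ∫ x in Icc (0 : ℝ) 1, (increment k (x, z) ^ 2 + unifValue k (nextValue k (x, z)) / 3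
        + b * (nextValue k (x, z) - 1)) =
      (∫ x in z..reach (unifValue k) z, (1 + unifValue k x - unifValue k z) ^ 2)
        - gain (unifValue k) z ^ 2
        + (unifValue (k + 1) z - (reach (unifValue k) z - z)) / 3
        + b * ((reach (unifValue k) z - z) ^ 2 / 2 + (z - 1)) := by
  classical
  have hc := continuous_unifValue k
  set D := gain (unifValue k) z with hD
  have e : ∀ x, increment k (x, z) ^ 2 + unifValue k (nextValue k (x, z)) / 3
        + b * (nextValue k (x, z) - 1) =
      if (x, z) ∈ acceptSet k then (1 + unifValue k x - unifValue k z) ^ 2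
        + (1 / 3 - 2 * D) * (1 + unifValue k x - unifValue k z)
        + (b * (x - z) + (D ^ 2 + (unifValue k z - 1) / 3 + b * (z - 1)))
        else D ^ 2 + unifValue k z / 3 + b * (z - 1) := by
    intro x
    by_cases hq : (x, z) ∈ acceptSet k
    · simp only [increment, nextValue, hq, if_true]
      ring
    · simp only [increment, nextValue, hq, if_false]
      ring
  simp_rw [e]
  rw [integral_ite_acceptSet k hz (by fun_prop), integral_excess_quadratic k hz]
  have : unifValue (k + 1) z = unifValue k z + D := rfl
  rw [this, ← hD]
  ring

theorem integral_increment_sq_le (hz : z ∈ Icc (0 : ℝ) 1) :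
    ∫ x in Icc (0 : ℝ) 1, (increment k (x, z) ^ 2 + unifValue k (nextValue k (x, z)) / 3) ≤
      unifValue (k + 1) z / 3 + 2 / 3 * (1 / (k + 1)) := by
  have h := integral_increment_sq_add k hz 0
  simp only [zero_mul, add_zero] at h
  rw [h]
  have h1 := integral_sq_le k hz.1 hz.2
  have h2 := sq_nonneg (gain (unifValue k) z)
  linarith

/-- The square of the conditional mean is compensated by the expected advance of the last accepted
value. -/
theorem le_integral_increment_sq (hz : z ∈ Icc (0 : ℝ) 1) :
    unifValue (k + 1) z / 3 - 2 * (1 - z) ≤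
    ∫ x in Icc (0 : ℝ) 1, (increment k (x, z) ^ 2 + unifValue k (nextValue k (x, z)) / 3
        + 2 * (nextValue k (x, z) - 1)) := by
  have H := isProfile_unifValue k
  rw [integral_increment_sq_add k hz 2]
  have h1 := H.le_integral_sq hz.1 hz.2
  have h2 := pow_le_pow_left₀ (gain_nonneg (unifValue k) hz.2) (H.gain_le hz.1 hz.2) 2
  linarith

end Kernel

section Independence

variable {Ω : Type*} {m mΩ : MeasurableSpace Ω} {μ : Measure Ω} [IsProbabilityMeasure μ]
  {U Z : Ω → ℝ}

/-- Freezing lemma: conditionally on `m`, an independent variable is integrated out while an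
`m`-measurable one is held fixed. -/
theorem condExp_comp_prod_of_indep (hm : m ≤ mΩ) (hU : Measurable U)
    (hind : Indep (MeasurableSpace.comap U inferInstance) m μ) (hZ : Measurable[m] Z)
    {φ : ℝ × ℝ → ℝ} (hφ : Measurable φ) (hint : Integrable (fun ω => φ (U ω, Z ω)) μ) :
    μ[fun ω => φ (U ω, Z ω)|m] =ᵐ[μ] fun ω => ∫ x, φ (x, Z ω) ∂(μ.map U) := by
  have hZ' : Measurable Z := hZ.mono hm le_rfl
  have : IsProbabilityMeasure (μ.map U) := Measure.isProbabilityMeasure_map hU.aemeasurable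
  have hindZ : ∀ {β : Type} [MeasurableSpace β] (Y : Ω → β), Measurable[m] Y →
      μ.map (fun ω => (U ω, Y ω)) = (μ.map U).prod (μ.map Y) := by
    intro β _ Y hY
    have : IndepFun U Y μ := by
      rw [IndepFun_iff_Indep]
      exact indep_of_indep_of_le_right hind hY.comap_le
    exact (indepFun_iff_map_prod_eq_prod_map_map hU.aemeasurable
      (hY.mono hm le_rfl).aemeasurable).1 this
  have hprodint : Integrable φ ((μ.map U).prod (μ.map Z)) := by
    rw [← hindZ Z hZ]
    exact (integrable_map_measure hφ.aestronglyMeasurable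
      (hU.prodMk hZ').aemeasurable).2 hint
  have hsm : StronglyMeasurable (fun z => ∫ x, φ (x, z) ∂(μ.map U)) :=
    hφ.stronglyMeasurable.integral_prod_left'
  have hint2 : Integrable (fun ω => ∫ x, φ (x, Z ω) ∂(μ.map U)) μ :=
    (integrable_map_measure hsm.aestronglyMeasurable hZ'.aemeasurable).1
      hprodint.integral_prod_right
  refine (ae_eq_condExp_of_forall_setIntegral_eq hm hint (fun _ _ _ => hint2.integrableOn)
    (fun A hA _ => ?_) ?_).symm
  · have hA' := hm A hA
    -- Carrying the indicator of `A` along with `Z` turns the claim into Fubini's theorem.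
    set Y : Ω → ℝ × ℝ := fun ω => (Z ω, A.indicator (fun _ => (1 : ℝ)) ω) with hYdef
    have hind1 : Measurable[m] (A.indicator fun _ => (1 : ℝ)) :=
      Measurable.indicator measurable_const hA
    have hY : Measurable[m] Y := hZ.prodMk hind1
    have hY' : Measurable Y := hY.mono hm le_rfl
    set ψ : ℝ × (ℝ × ℝ) → ℝ := fun q => q.2.2 * φ (q.1, q.2.1) with hψdef
    have hψ : Measurable ψ := by fun_prop
    have e1 : ∀ ω, ψ (U ω, Y ω) = A.indicator (fun ω => φ (U ω, Z ω)) ω := by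
      intro ω
      by_cases hω : ω ∈ A <;> simp [hψdef, hYdef, hω]
    have hψint : Integrable ψ ((μ.map U).prod (μ.map Y)) := by
      rw [← hindZ Y hY]
      refine (integrable_map_measure hψ.aestronglyMeasurable
        (hU.prodMk hY').aemeasurable).2 ?_
      exact (hint.indicator hA').congr (Eventually.of_forall fun ω => (e1 ω).symm)
    have e2 : ∀ ω, ∫ x, ψ (x, Y ω) ∂(μ.map U) =
        A.indicator (fun ω => ∫ x, φ (x, Z ω) ∂(μ.map U)) ω := by
      intro ω
      by_cases hω : ω ∈ A <;> simp [hψdef, hYdef, hω]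
    calc ∫ ω in A, ∫ x, φ (x, Z ω) ∂(μ.map U) ∂μ
        = ∫ ω, ∫ x, ψ (x, Y ω) ∂(μ.map U) ∂μ := by
          rw [← integral_indicator hA']
          exact integral_congr_ae (Eventually.of_forall fun ω => (e2 ω).symm)
      _ = ∫ y, ∫ x, ψ (x, y) ∂(μ.map U) ∂(μ.map Y) := by
          rw [integral_map hY'.aemeasurable
            hψ.stronglyMeasurable.integral_prod_left'.aestronglyMeasurable]
      _ = ∫ q, ψ q ∂((μ.map U).prod (μ.map Y)) := (integral_prod_symm ψ hψint).symm
      _ = ∫ ω, ψ (U ω, Y ω) ∂μ := by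
          rw [← hindZ Y hY, integral_map (hU.prodMk hY').aemeasurable hψ.aestronglyMeasurable]
      _ = ∫ ω in A, φ (U ω, Z ω) ∂μ := by
          rw [← integral_indicator hA']
          exact integral_congr_ae (Eventually.of_forall e1)
  · exact (hsm.measurable.comp hZ).stronglyMeasurable.aestronglyMeasurable

theorem ae_notMem_of_indep (hU : Measurable U) (hZ : Measurable Z) (hind : IndepFun U Z μ)
    {B : Set (ℝ × ℝ)} (hB : MeasurableSet B)
    (hnull : ∀ ω, μ.map U {x | (x, Z ω) ∈ B} = 0) : ∀ᵐ ω ∂μ, (U ω, Z ω) ∉ B := by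
  have : IsProbabilityMeasure (μ.map U) := Measure.isProbabilityMeasure_map hU.aemeasurable
  have h := (indepFun_iff_map_prod_eq_prod_map_map hU.aemeasurable hZ.aemeasurable).1 hind
  have h0 : (μ.map U).prod (μ.map Z) B = 0 := by
    rw [Measure.prod_apply_symm hB, lintegral_map (measurable_measure_prodMk_right hB) hZ]
    exact (lintegral_congr hnull).trans lintegral_zero
  rw [← h, Measure.map_apply (hU.prodMk hZ) hB] at h0
  exact compl_mem_ae_iff.2 h0

end Independence

/-! ### Feasible policies and the Bellman bound -/

/-- The observations `X_1, …, X_n` are independent with the continuous distribution `F` on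
`[0, ∞)`. -/
structure IsSample {Ω : Type*} [MeasurableSpace Ω] (μ : Measure Ω) (F : Measure ℝ) (n : ℕ)
    (X : ℕ → Ω → ℝ) : Prop where
  cont : Continuous (fun x => cdf F x)
  nonneg : F (Iio 0) = 0
  meas : ∀ i ∈ Finset.Icc 1 n, Measurable (X i)
  law : ∀ i ∈ Finset.Icc 1 n, μ.map (X i) = F
  indep : iIndepFun (fun i : Finset.Icc 1 n => X i) μ

/-- The last accepted value, on the uniform scale. -/
def position {Ω : Type*} (F : Measure ℝ) (X : ℕ → Ω → ℝ) (S : ℕ → Set Ω) (i : ℕ) (ω : Ω) : ℝ :=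
  cdf F (lastSelected X S i ω)

/-- The number of acceptances after time `i`, minus its conditional expected value
under the optimal rule. -/
def residual {Ω : Type*} (F : Measure ℝ) (X : ℕ → Ω → ℝ) (S : ℕ → Set Ω) (n i : ℕ) (ω : Ω) : ℝ :=
  count S n ω - count S i ω - unifValue (n - i) (position F X S i ω)

open scoped Classical in
/-- The increment of `L_i + v_{n-i}(M_i)` at time `i + 1` under the policy `S`, when `k` further
observations are to come. -/
def policyIncrement {Ω : Type*} (F : Measure ℝ) (X : ℕ → Ω → ℝ) (S : ℕ → Set Ω) (k i : ℕ) (ω : Ω) :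
    ℝ :=
  (if ω ∈ S (i + 1) then
    1 + unifValue k (cdf F (X (i + 1) ω)) - unifValue k (position F X S i ω) else 0)
    - gain (unifValue k) (position F X S i ω)

/-- The policy `S` almost surely takes the optimal decisions. -/
def IsBellman {Ω : Type*} [MeasurableSpace Ω] (μ : Measure Ω) (F : Measure ℝ) (X : ℕ → Ω → ℝ)
    (n : ℕ) (S : ℕ → Set Ω) : Prop :=
  ∀ i k, i + k + 1 = n → ∀ᵐ ω ∂μ,
    (ω ∈ S (i + 1) ↔ (cdf F (X (i + 1) ω), position F X S i ω) ∈ acceptSet k)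

section Basic

variable {Ω : Type*} {F : Measure ℝ} {n : ℕ} {X : ℕ → Ω → ℝ} {S : ℕ → Set Ω} {i j k : ℕ}

theorem history_mono (hij : i ≤ j) : history X i ≤ history X j :=
  biSup_mono fun _ hk => Finset.Icc_subset_Icc_right hij hk

theorem measurable_history (hj : j ∈ Finset.Icc 1 i) : Measurable[history X i] (X j) :=
  measurable_iff_comap_le.2 (le_iSup₂ (f := fun j (_ : j ∈ Finset.Icc 1 i) =>
    MeasurableSpace.comap (X j) inferInstance) j hj)

theorem position_mem (F : Measure ℝ) (X : ℕ → Ω → ℝ) (S : ℕ → Set Ω) (i : ℕ) (ω : Ω) :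
    position F X S i ω ∈ Icc (0 : ℝ) 1 := cdf_mem_Icc F _

theorem count_succ (S : ℕ → Set Ω) (i : ℕ) (ω : Ω) :
    count S (i + 1) ω = count S i ω + (S (i + 1)).indicator (fun _ => (1 : ℝ)) ω :=
  Finset.sum_Icc_succ_top (by omega) _

theorem count_mem (S : ℕ → Set Ω) (i : ℕ) (ω : Ω) : count S i ω ∈ Icc (0 : ℝ) i := by
  induction i with
  | zero => simp [count]
  | succ i ih =>
    rw [count_succ]
    have h : (S (i + 1)).indicator (fun _ => (1 : ℝ)) ω ∈ Icc (0 : ℝ) 1 := by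
      by_cases hω : ω ∈ S (i + 1) <;> simp [hω]
    push_cast
    exact ⟨by linarith [ih.1, h.1], by linarith [ih.2, h.2]⟩

theorem residual_self (F : Measure ℝ) (X : ℕ → Ω → ℝ) (S : ℕ → Set Ω) (n : ℕ) (ω : Ω) :
    residual F X S n n ω = 0 := by
  simp [residual, unifValue]

theorem residual_eq (F : Measure ℝ) (X : ℕ → Ω → ℝ) (S : ℕ → Set Ω) (hn : i + k + 1 = n) (ω : Ω) :
    residual F X S n i ω = policyIncrement F X S k i ω + residual F X S n (i + 1) ω := by
  have h1 : n - i = k + 1 := by omega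
  have h2 : n - (i + 1) = k := by omega
  simp only [residual, policyIncrement, h1, h2, count_succ, unifValue]
  by_cases hω : ω ∈ S (i + 1)
  · simp only [hω, if_true, indicator_of_mem, position, lastSelected]
    ring
  · simp only [hω, if_false, not_false_eq_true, indicator_of_notMem, position, lastSelected]
    ring

theorem abs_residual_le (F : Measure ℝ) (X : ℕ → Ω → ℝ) (S : ℕ → Set Ω) (hi : i ≤ n) (ω : Ω) :
    |residual F X S n i ω| ≤ 2 * n := by
  have h1 := count_mem S n ω
  have h2 := count_mem S i ω
  have h3 := unifValue_mem (n - i) (position_mem F X S i ω).1 (position_mem F X S i ω).2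
  rw [mem_Icc, Nat.cast_sub hi] at h3
  have h4 : (i : ℝ) ≤ n := Nat.cast_le.2 hi
  rw [residual, abs_le]
  constructor <;> linarith [h1.1, h1.2, h2.1, h2.2, h3.1, h3.2]

theorem gain_unifValue_mem (k : ℕ) {z : ℝ} (hz : z ∈ Icc (0 : ℝ) 1) :
    gain (unifValue k) z ∈ Icc (0 : ℝ) 1 := by
  have H := isProfile_unifValue k
  refine ⟨gain_nonneg _ hz.2, (H.gain_le hz.1 hz.2).trans ?_⟩
  linarith [(H.reach_mem hz.2).1.2, hz.1]

theorem abs_increment_le (k : ℕ) {q : ℝ × ℝ} (h1 : q.1 ∈ Icc (0 : ℝ) 1)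
    (h2 : q.2 ∈ Icc (0 : ℝ) 1) : |increment k q| ≤ k + 2 := by
  have a1 := unifValue_mem k h1.1 h1.2
  have a2 := unifValue_mem k h2.1 h2.2
  have a3 := gain_unifValue_mem k h2
  have a4 : (0 : ℝ) ≤ k := k.cast_nonneg
  simp only [mem_Icc] at a1 a2 a3
  rw [increment, abs_le]
  split_ifs <;> constructor <;> linarith

theorem nextValue_mem (k : ℕ) {q : ℝ × ℝ} (h1 : q.1 ∈ Icc (0 : ℝ) 1)
    (h2 : q.2 ∈ Icc (0 : ℝ) 1) : nextValue k q ∈ Icc (0 : ℝ) 1 := by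
  rw [nextValue]
  split_ifs
  exacts [h1, h2]

theorem policyIncrement_eq {ω : Ω}
    (h : ω ∈ S (i + 1) ↔ (cdf F (X (i + 1) ω), position F X S i ω) ∈ acceptSet k) :
    policyIncrement F X S k i ω = increment k (cdf F (X (i + 1) ω), position F X S i ω) := by
  rw [policyIncrement, increment]
  by_cases hω : ω ∈ S (i + 1)
  · rw [if_pos hω, if_pos (h.1 hω)]
  · rw [if_neg hω, if_neg (mt h.2 hω)]

theorem position_succ_eq {ω : Ω}
    (h : ω ∈ S (i + 1) ↔ (cdf F (X (i + 1) ω), position F X S i ω) ∈ acceptSet k) :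
    position F X S (i + 1) ω = nextValue k (cdf F (X (i + 1) ω), position F X S i ω) := by
  by_cases hω : ω ∈ S (i + 1)
  · rw [nextValue, if_pos (h.1 hω)]
    simp [position, lastSelected, hω]
  · rw [nextValue, if_neg (mt h.2 hω)]
    simp [position, lastSelected, hω]

/-- No decision increases the Bellman potential by more than the optimal one, as long as the
accepted values do not decrease. -/
theorem policyIncrement_le {ω : Ω}
    (h : ω ∈ S (i + 1) → position F X S i ω ≤ cdf F (X (i + 1) ω)) :
    policyIncrement F X S k i ω ≤ increment k (cdf F (X (i + 1) ω), position F X S i ω) := by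
  rw [policyIncrement, increment]
  refine sub_le_sub_right ?_ _
  split_ifs with h1 h2 h2
  · exact le_rfl
  · by_contra! hcon
    exact h2 ⟨h h1, by linarith⟩
  · linarith [h2.2]
  · exact le_rfl

/-- Conversely, equality determines the decision, unless accepting and rejecting are tied. -/
theorem mem_iff_of_policyIncrement_eq {ω : Ω}
    (h : ω ∈ S (i + 1) → position F X S i ω ≤ cdf F (X (i + 1) ω))
    (htie : position F X S i ω ≤ cdf F (X (i + 1) ω) →
      1 + unifValue k (cdf F (X (i + 1) ω)) - unifValue k (position F X S i ω) ≠ 0)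
    (heq : policyIncrement F X S k i ω =
      increment k (cdf F (X (i + 1) ω), position F X S i ω)) :
    ω ∈ S (i + 1) ↔ (cdf F (X (i + 1) ω), position F X S i ω) ∈ acceptSet k := by
  rw [policyIncrement, increment, sub_left_inj] at heq
  constructor
  · intro h1
    by_contra h2
    rw [if_pos h1, if_neg h2] at heq
    exact htie (h h1) heq
  · intro h2
    by_contra h1
    rw [if_neg h1, if_pos h2] at heq
    exact htie h2.1 heq.symm

theorem lastSelected_eq_or (X : ℕ → Ω → ℝ) (S : ℕ → Set Ω) (i : ℕ) (ω : Ω) :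
    lastSelected X S i ω = 0 ∨
      ∃ j ∈ Finset.Icc 1 i, ω ∈ S j ∧ lastSelected X S i ω = X j ω := by
  induction i with
  | zero => exact Or.inl rfl
  | succ i ih =>
    by_cases hω : ω ∈ S (i + 1)
    · exact Or.inr ⟨i + 1, by simp, hω, by simp [lastSelected, hω]⟩
    · have e : lastSelected X S (i + 1) ω = lastSelected X S i ω := by simp [lastSelected, hω]
      rw [e]
      rcases ih with h | ⟨j, hj, h⟩
      · exact Or.inl h
      · exact Or.inr ⟨j, Finset.Icc_subset_Icc_right i.le_succ hj, h⟩

theorem IsPolicy.measurable_lastSelected (hS : IsPolicy X n S) (hi : i ≤ n) :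
    Measurable[history X i] (lastSelected X S i) := by
  classical
  induction i with
  | zero => exact measurable_const
  | succ i ih =>
    have h1 : Measurable[history X (i + 1)] (lastSelected X S i) :=
      (ih (by omega)).mono (history_mono i.le_succ) le_rfl
    have h2 := hS.adapted (i + 1) (by simp; omega)
    have h3 : Measurable[history X (i + 1)] (X (i + 1)) := measurable_history (by simp)
    exact Measurable.ite h2 h3 h1

theorem IsPolicy.measurable_count (hS : IsPolicy X n S) (hi : i ≤ n) :
    Measurable[history X i] (count S i) := by
  induction i with
  | zero =>
    have : count S 0 = fun _ => (0 : ℝ) := by funext ω; simp [count]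
    rw [this]
    exact measurable_const
  | succ i ih =>
    have h1 : Measurable[history X (i + 1)] (count S i) :=
      (ih (by omega)).mono (history_mono i.le_succ) le_rfl
    have h2 := hS.adapted (i + 1) (by simp; omega)
    have h3 : Measurable[history X (i + 1)] ((S (i + 1)).indicator fun _ => (1 : ℝ)) :=
      Measurable.indicator measurable_const h2
    have e : count S (i + 1) = fun ω => count S i ω + (S (i + 1)).indicator (fun _ => (1 : ℝ)) ω :=
      funext fun ω => count_succ S i ω
    rw [e]
    exact Measurable.add h1 h3

end Basic

namespace IsSample

variable {Ω : Type*} [mΩ : MeasurableSpace Ω] {μ : Measure Ω}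
  {F : Measure ℝ} {n : ℕ} {X : ℕ → Ω → ℝ} (hX : IsSample μ F n X)
  {S : ℕ → Set Ω} {i k : ℕ}

include hX

theorem history_le (hi : i ≤ n) : history X i ≤ mΩ :=
  iSup₂_le fun j hj => (hX.meas j (Finset.Icc_subset_Icc_right hi hj)).comap_le

theorem indep_history (hi : i < n) :
    Indep (MeasurableSpace.comap (X (i + 1)) inferInstance) (history X i) μ := by
  have hmem : i + 1 ∈ Finset.Icc 1 n := by simp; omega
  have h := indep_iSup_of_disjoint
    (m := fun j : Finset.Icc 1 n => MeasurableSpace.comap (X j) inferInstance)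
    (fun j => (hX.meas j j.2).comap_le) hX.indep
    (S := {⟨i + 1, hmem⟩}) (T := {j | (j : ℕ) ≤ i})
    (by
      rw [Set.disjoint_singleton_left]
      simp)
  refine indep_of_indep_of_le_left (indep_of_indep_of_le_right h ?_) ?_
  · refine iSup₂_le fun j hj => ?_
    have hj' := Finset.mem_Icc.1 hj
    exact le_iSup₂ (f := fun (j : Finset.Icc 1 n) (_ : j ∈ {j : Finset.Icc 1 n | (j : ℕ) ≤ i}) =>
      MeasurableSpace.comap (X j) inferInstance)
      ⟨j, Finset.mem_Icc.2 ⟨hj'.1, hj'.2.trans hi.le⟩⟩ hj'.2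
  · exact le_iSup₂ (f := fun (j : Finset.Icc 1 n) (_ : j ∈ ({⟨i + 1, hmem⟩} : Set _)) =>
      MeasurableSpace.comap (X j) inferInstance) ⟨i + 1, hmem⟩ rfl

theorem measurable_unif (hi : i < n) : Measurable (fun ω => cdf F (X (i + 1) ω)) :=
  hX.cont.measurable.comp (hX.meas (i + 1) (by simp; omega))

theorem measurable_unif_history : Measurable[history X (i + 1)] (fun ω => cdf F (X (i + 1) ω)) :=
  hX.cont.measurable.comp (measurable_history (by simp))

theorem indep_unif (hi : i < n) :
    Indep (MeasurableSpace.comap (fun ω => cdf F (X (i + 1) ω)) inferInstance)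
      (history X i) μ := by
  refine indep_of_indep_of_le_left (hX.indep_history hi) ?_
  have : Measurable[MeasurableSpace.comap (X (i + 1)) inferInstance]
      (fun ω => cdf F (X (i + 1) ω)) := hX.cont.measurable.comp (comap_measurable _)
  exact this.comap_le

theorem measurable_position (hS : IsPolicy X n S) (hi : i ≤ n) :
    Measurable[history X i] (position F X S i) :=
  hX.cont.measurable.comp (hS.measurable_lastSelected hi)

theorem ae_position_le (hS : IsPolicy X n S) (hi : i < n) :
    ∀ᵐ ω ∂μ, ω ∈ S (i + 1) → position F X S i ω ≤ cdf F (X (i + 1) ω) := by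
  have hmem : i + 1 ∈ Finset.Icc 1 n := by simp; omega
  have h0 : ∀ᵐ ω ∂μ, 0 ≤ X (i + 1) ω := by
    have : ∀ᵐ x ∂(μ.map (X (i + 1))), 0 ≤ x := by
      rw [hX.law (i + 1) hmem]
      filter_upwards [compl_mem_ae_iff.2 hX.nonneg] with x hx
      exact not_lt.1 hx
    exact ae_of_ae_map (hX.meas _ hmem).aemeasurable this
  filter_upwards [h0] with ω hω hSω
  refine monotone_cdf F ?_
  rcases lastSelected_eq_or X S i ω with h | ⟨j, hj, hjS, h⟩
  · rwa [h]
  · rw [h]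
    have hj' := Finset.mem_Icc.1 hj
    exact hS.monotone j (Finset.mem_Icc.2 ⟨hj'.1, hj'.2.trans hi.le⟩) (i + 1) hmem (by omega) ω
      hjS hSω

theorem measurable_residual (hS : IsPolicy X n S) (hi : i ≤ n) :
    Measurable (residual F X S n i) := by
  have h1 := (hS.measurable_count le_rfl).mono (hX.history_le le_rfl) le_rfl
  have h2 := (hS.measurable_count hi).mono (hX.history_le hi) le_rfl
  have h3 := (hX.measurable_position hS hi).mono (hX.history_le hi) le_rfl
  exact (h1.sub h2).sub ((continuous_unifValue _).measurable.comp h3)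

theorem integrable_residual [IsProbabilityMeasure μ] (hS : IsPolicy X n S) (hi : i ≤ n) :
    Integrable (residual F X S n i) μ :=
  Integrable.of_bound (C := 2 * n) (hX.measurable_residual hS hi).aestronglyMeasurable
    (Eventually.of_forall fun ω => abs_residual_le F X S hi ω)

theorem integrable_residual_sq [IsProbabilityMeasure μ] (hS : IsPolicy X n S) (hi : i ≤ n) :
    Integrable (fun ω => residual F X S n i ω ^ 2) μ := by
  refine Integrable.of_bound (C := (2 * n) ^ 2)
    ((hX.measurable_residual hS hi).pow_const 2).aestronglyMeasurable
    (Eventually.of_forall fun ω => ?_)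
  rw [Real.norm_eq_abs, abs_pow]
  exact pow_le_pow_left₀ (abs_nonneg _) (abs_residual_le F X S hi ω) 2

theorem integrable_policyIncrement [IsProbabilityMeasure μ] (hS : IsPolicy X n S)
    (hn : i + k + 1 = n) : Integrable (policyIncrement F X S k i) μ := by
  have h := (hX.integrable_residual hS (i := i) (by omega)).sub
    (hX.integrable_residual hS (i := i + 1) (by omega))
  refine h.congr (Eventually.of_forall fun ω => ?_)
  simp [residual_eq F X S hn ω]

theorem integral_residual_eq_sum [IsProbabilityMeasure μ] (hS : IsPolicy X n S) (hi : i ≤ n) :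
    ∫ ω, residual F X S n 0 ω ∂μ =
      (∑ j ∈ Finset.range i, ∫ ω, policyIncrement F X S (n - (j + 1)) j ω ∂μ)
        + ∫ ω, residual F X S n i ω ∂μ := by
  induction i with
  | zero => simp
  | succ i ih =>
    have hn : i + (n - (i + 1)) + 1 = n := by omega
    rw [ih (by omega), Finset.sum_range_succ, integral_congr_ae
      (Eventually.of_forall fun ω => residual_eq F X S hn ω),
      integral_add (hX.integrable_policyIncrement hS hn)
        (hX.integrable_residual hS hi)]
    ring

variable [IsProbabilityMeasure F]

theorem map_unif (hi : i < n) :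
    μ.map (fun ω => cdf F (X (i + 1) ω)) = volume.restrict (Icc 0 1) := by
  have hmem : i + 1 ∈ Finset.Icc 1 n := by simp; omega
  rw [← map_cdf_eq F hX.cont, ← hX.law (i + 1) hmem,
    Measure.map_map (by rw [hX.law (i + 1) hmem]; exact hX.cont.measurable)
      (hX.meas (i + 1) hmem), hX.law (i + 1) hmem]
  rfl

theorem ae_unif_lt_one (hi : i < n) : ∀ᵐ ω ∂μ, cdf F (X (i + 1) ω) < 1 := by
  have hm := hX.measurable_unif hi
  have h : ∀ᵐ y ∂(μ.map fun ω => cdf F (X (i + 1) ω)), y ≠ 1 := by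
    rw [hX.map_unif hi]
    exact ae_restrict_of_ae (Measure.ae_ne volume 1)
  filter_upwards [ae_of_ae_map hm.aemeasurable h] with ω hω
  exact lt_of_le_of_ne (cdf_le_one F _) hω

variable [IsProbabilityMeasure μ]

theorem ae_notMem (hS : IsPolicy X n S) (hi : i < n) {B : Set (ℝ × ℝ)} (hB : MeasurableSet B)
    (hnull : ∀ z ∈ Icc (0 : ℝ) 1, volume {x | x ∈ Icc (0 : ℝ) 1 ∧ (x, z) ∈ B} = 0) :
    ∀ᵐ ω ∂μ, (cdf F (X (i + 1) ω), position F X S i ω) ∉ B := by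
  have hZ := hX.measurable_position hS hi.le
  refine ae_notMem_of_indep (hX.measurable_unif hi) (hZ.mono (hX.history_le hi.le) le_rfl) ?_ hB ?_
  · rw [IndepFun_iff_Indep]
    exact indep_of_indep_of_le_right (hX.indep_unif hi) hZ.comap_le
  · intro ω
    rw [hX.map_unif hi]
    have hms : MeasurableSet {x | (x, position F X S i ω) ∈ B} := measurable_prodMk_right hB
    rw [Measure.restrict_apply hms]
    refine measure_mono_null ?_ (hnull _ (position_mem F X S i ω))
    exact fun x hx => ⟨hx.2, hx.1⟩

theorem ae_unif_ne_position (hS : IsPolicy X n S) (hi : i < n) :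
    ∀ᵐ ω ∂μ, cdf F (X (i + 1) ω) ≠ position F X S i ω := by
  refine hX.ae_notMem hS hi (B := {q | q.1 = q.2})
    (measurableSet_eq_fun measurable_fst measurable_snd) fun z _ => ?_
  refine Set.Subsingleton.measure_zero ?_ _
  intro x hx y hy
  exact hx.2.trans hy.2.symm

theorem ae_no_tie (hS : IsPolicy X n S) (hi : i < n) (k : ℕ) :
    ∀ᵐ ω ∂μ, position F X S i ω ≤ cdf F (X (i + 1) ω) →
      1 + unifValue k (cdf F (X (i + 1) ω)) - unifValue k (position F X S i ω) ≠ 0 := by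
  have hc := (continuous_unifValue k).measurable
  have h := hX.ae_notMem hS hi (B := {q | q.2 ≤ q.1 ∧ 1 + unifValue k q.1 - unifValue k q.2 = 0})
    ((measurableSet_le measurable_snd measurable_fst).inter
      (measurableSet_eq_fun ((measurable_const.add (hc.comp measurable_fst)).sub
        (hc.comp measurable_snd)) measurable_const)) fun z hz => by
      refine Set.Subsingleton.measure_zero ((subsingleton_tie k hz.1).anti ?_) _
      exact fun x hx => ⟨⟨hx.2.1, hx.1.2⟩, hx.2.2⟩
  filter_upwards [h] with ω hω h1 h2
  exact hω ⟨h1, h2⟩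

theorem condExp_comp (hS : IsPolicy X n S) (hi : i < n) {φ : ℝ × ℝ → ℝ} (hφ : Measurable φ)
    {C : ℝ} (hC : ∀ q : ℝ × ℝ, q.1 ∈ Icc (0 : ℝ) 1 → q.2 ∈ Icc (0 : ℝ) 1 → |φ q| ≤ C) :
    Integrable (fun ω => φ (cdf F (X (i + 1) ω), position F X S i ω)) μ ∧
    μ[fun ω => φ (cdf F (X (i + 1) ω), position F X S i ω)|history X i] =ᵐ[μ]
      fun ω => ∫ x in Icc (0 : ℝ) 1, φ (x, position F X S i ω) := by
  have hZ := hX.measurable_position hS hi.le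
  have hU := hX.measurable_unif hi
  have hint : Integrable (fun ω => φ (cdf F (X (i + 1) ω), position F X S i ω)) μ := by
    refine Integrable.of_bound (C := C) (hφ.comp (hU.prodMk
      (hZ.mono (hX.history_le hi.le) le_rfl))).aestronglyMeasurable (Eventually.of_forall ?_)
    intro ω
    exact hC _ (cdf_mem_Icc F _) (position_mem F X S i ω)
  refine ⟨hint, ?_⟩
  have := condExp_comp_prod_of_indep (hX.history_le hi.le) hU (hX.indep_unif hi) hZ hφ hint
  rwa [hX.map_unif hi] at this

/-- The optimal increments are martingale differences. -/
theorem condExp_increment (hS : IsPolicy X n S) (hi : i < n) (k : ℕ) :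
    Integrable (fun ω => increment k (cdf F (X (i + 1) ω), position F X S i ω)) μ ∧
    μ[fun ω => increment k (cdf F (X (i + 1) ω), position F X S i ω)|history X i] =ᵐ[μ] 0 := by
  obtain ⟨h1, h2⟩ := hX.condExp_comp hS hi (measurable_increment k)
    (fun q => abs_increment_le k (q := q))
  refine ⟨h1, h2.trans (Eventually.of_forall fun ω => ?_)⟩
  exact integral_increment k (position_mem F X S i ω)

theorem integral_increment_eq_zero (hS : IsPolicy X n S) (hi : i < n) (k : ℕ) :
    ∫ ω, increment k (cdf F (X (i + 1) ω), position F X S i ω) ∂μ = 0 := by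
  rw [← integral_condExp (hX.history_le hi.le),
    integral_congr_ae (hX.condExp_increment hS hi k).2]
  simp

theorem integral_policyIncrement_nonpos (hS : IsPolicy X n S) (hn : i + k + 1 = n) :
    ∫ ω, policyIncrement F X S k i ω ∂μ ≤ 0 := by
  have hi : i < n := by omega
  rw [← hX.integral_increment_eq_zero hS hi k]
  refine integral_mono_ae (hX.integrable_policyIncrement hS hn)
    (hX.condExp_increment hS hi k).1 ?_
  filter_upwards [hX.ae_position_le hS hi] with ω hω
  exact policyIncrement_le hω

theorem integral_residual_zero (hS : IsPolicy X n S) :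
    ∫ ω, residual F X S n 0 ω ∂μ = (∫ ω, count S n ω ∂μ) - unifValue n 0 := by
  have h0 : ∀ ω, residual F X S n 0 ω = count S n ω - unifValue n 0 := by
    intro ω
    have : position F X S 0 ω = 0 := by
      simp [position, lastSelected, cdf_zero_eq F hX.cont hX.nonneg]
    simp [residual, count, this]
  have hint : Integrable (count S n) μ := by
    refine ((hX.integrable_residual hS n.zero_le).add (integrable_const (unifValue n 0))).congr
      (Eventually.of_forall fun ω => ?_)
    simp [h0]
  simp_rw [h0]
  rw [integral_sub hint (integrable_const _)]
  simp

theorem integral_count_eq_sum (hS : IsPolicy X n S) :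
    ∫ ω, count S n ω ∂μ = unifValue n 0 +
      ∑ j ∈ Finset.range n, ∫ ω, policyIncrement F X S (n - (j + 1)) j ω ∂μ := by
  have h1 := hX.integral_residual_zero hS
  have h2 := hX.integral_residual_eq_sum hS le_rfl
  simp only [residual_self, integral_zero, add_zero] at h2
  linarith

/-- The supermartingale bound: no policy beats the Bellman value. -/
theorem integral_count_le (hS : IsPolicy X n S) : ∫ ω, count S n ω ∂μ ≤ unifValue n 0 := by
  rw [hX.integral_count_eq_sum hS]
  have := Finset.sum_nonpos (s := Finset.range n)
    (f := fun j => ∫ ω, policyIncrement F X S (n - (j + 1)) j ω ∂μ) fun j hj =>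
      hX.integral_policyIncrement_nonpos hS (by have := Finset.mem_range.1 hj; omega)
  linarith

theorem integral_count_eq (hS : IsPolicy X n S) (hB : IsBellman μ F X n S) :
    ∫ ω, count S n ω ∂μ = unifValue n 0 := by
  rw [hX.integral_count_eq_sum hS, Finset.sum_eq_zero, add_zero]
  intro j hj
  have hj' := Finset.mem_range.1 hj
  rw [← hX.integral_increment_eq_zero hS hj' (n - (j + 1))]
  refine integral_congr_ae ?_
  filter_upwards [hB j (n - (j + 1)) (by omega)] with ω hω
  exact policyIncrement_eq hω

/-- A policy that attains the Bellman value cannot lose anything at any time, so it takes the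
optimal decisions. -/
theorem isBellman_of_le (hS : IsPolicy X n S) (hopt : unifValue n 0 ≤ ∫ ω, count S n ω ∂μ) :
    IsBellman μ F X n S := by
  intro i k hn
  have hi : i < n := by omega
  have hsum := hX.integral_count_eq_sum hS
  have hnonpos : ∀ j ∈ Finset.range n,
      ∫ ω, policyIncrement F X S (n - (j + 1)) j ω ∂μ ≤ 0 := fun j hj =>
    hX.integral_policyIncrement_nonpos hS (by have := Finset.mem_range.1 hj; omega)
  have hzero := (Finset.sum_eq_zero_iff_of_nonpos hnonpos).1
    (le_antisymm (Finset.sum_nonpos hnonpos) (by linarith)) i (Finset.mem_range.2 hi)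
  have hk : n - (i + 1) = k := by omega
  rw [hk, ← hX.integral_increment_eq_zero hS hi k] at hzero
  have hle := hX.ae_position_le hS hi
  have heq := (integral_eq_iff_of_ae_le (hX.integrable_policyIncrement hS hn)
    (hX.condExp_increment hS hi k).1 (by
      filter_upwards [hle] with ω hω
      exact policyIncrement_le hω)).1 hzero
  filter_upwards [heq, hle, hX.ae_no_tie hS hi k] with ω h1 h2 h3
  exact mem_iff_of_policyIncrement_eq h2 h3 h1

end IsSample

/-! ### The threshold policy and the conditional variance -/

section Threshold

variable {Ω : Type*} [mΩ : MeasurableSpace Ω] {μ : Measure Ω} {F : Measure ℝ}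
  [IsProbabilityMeasure F] {n : ℕ} {X : ℕ → Ω → ℝ} {S : ℕ → Set Ω} {i j k : ℕ}

/-- The acceptance region of the threshold policy, as a set of pairs (observation, last accepted
value). -/
theorem measurableSet_threshold_region (hF : Continuous (fun x => cdf F x)) (k : ℕ) :
    MeasurableSet {q : ℝ × ℝ | q.2 ≤ q.1 ∧ (q.1 : EReal) ≤ threshold F (k + 1) q.2} :=
  (measurableSet_le measurable_snd measurable_fst).inter
    (measurableSet_le measurable_fst.coe_real_ereal
      ((measurable_threshold F hF k).comp measurable_snd))

omit mΩ in
theorem measurable_thresholdMax (hF : Continuous (fun x => cdf F x)) (hi : i ≤ n) :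
    Measurable[history X i] (thresholdMax F X n i) := by
  classical
  induction i with
  | zero => exact measurable_const
  | succ i ih =>
    have h1 : Measurable[history X (i + 1)] (thresholdMax F X n i) :=
      (ih (by omega)).mono (history_mono i.le_succ) le_rfl
    have h3 : Measurable[history X (i + 1)] (X (i + 1)) := measurable_history (by simp)
    obtain ⟨k, hk⟩ : ∃ k, n - i = k + 1 := ⟨n - i - 1, by omega⟩
    have h2 := (h3.prodMk h1) (measurableSet_threshold_region hF k)
    rw [← hk] at h2
    exact Measurable.ite h2 h3 h1

omit mΩ [IsProbabilityMeasure F] in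
theorem thresholdMax_mono (hij : i ≤ j) (ω : Ω) :
    thresholdMax F X n i ω ≤ thresholdMax F X n j ω := by
  induction j, hij using Nat.le_induction with
  | base => exact le_rfl
  | succ j _ ih =>
    refine ih.trans ?_
    rw [thresholdMax]
    split_ifs with h
    · exact h.1
    · exact le_rfl

omit mΩ in
theorem isPolicy_thresholdPolicy (hF : Continuous (fun x => cdf F x)) :
    IsPolicy X n (thresholdPolicy F X n) := by
  constructor
  · intro i hi
    have hi' := Finset.mem_Icc.1 hi
    obtain ⟨l, rfl⟩ : ∃ l, i = l + 1 := ⟨i - 1, by omega⟩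
    obtain ⟨k, hk⟩ : ∃ k, n - l = k + 1 := ⟨n - l - 1, by omega⟩
    have h1 : Measurable[history X (l + 1)] (thresholdMax F X n l) :=
      (measurable_thresholdMax hF (by omega)).mono (history_mono l.le_succ) le_rfl
    have h3 : Measurable[history X (l + 1)] (X (l + 1)) := measurable_history (by simp)
    have h2 := (h3.prodMk h1) (measurableSet_threshold_region hF k)
    rw [← hk] at h2
    exact h2
  · intro i hi j _ hij ω hωi hωj
    have hi' := Finset.mem_Icc.1 hi
    obtain ⟨l, rfl⟩ : ∃ l, i = l + 1 := ⟨i - 1, by omega⟩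
    have e : thresholdMax F X n (l + 1) ω = X (l + 1) ω := by
      rw [thresholdMax, if_pos]
      exact hωi
    rw [← e]
    exact (thresholdMax_mono (by omega) ω).trans hωj.1

/-- The two acceptance rules differ only where the distribution function equals `1` or takes the
same value at the observation and at the last accepted value, which has probability zero. -/
theorem IsSample.isBellman_thresholdPolicy [IsProbabilityMeasure μ] (hX : IsSample μ F n X) :
    IsBellman μ F X n (thresholdPolicy F X n) := by
  intro i k hn
  have hi : i < n := by omega
  have hS : IsPolicy X n (thresholdPolicy F X n) := isPolicy_thresholdPolicy hX.cont
  have hk : n - i = k + 1 := by omega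
  filter_upwards [hX.ae_unif_ne_position hS hi, hX.ae_unif_lt_one hi] with ω hne hlt
  have hpos : position F X (thresholdPolicy F X n) i ω = cdf F (thresholdMax F X n i ω) := by
    rw [position, lastSelected_thresholdPolicy]
  rw [hpos] at hne ⊢
  have hiff : ω ∈ thresholdPolicy F X n (i + 1) ↔ thresholdMax F X n i ω ≤ X (i + 1) ω ∧
      (X (i + 1) ω : EReal) ≤ threshold F (k + 1) (thresholdMax F X n i ω) := by
    rw [← hk]
    rfl
  rw [hiff]
  constructor
  · rintro ⟨h1, h2⟩
    exact ⟨monotone_cdf F h1, le_one_add_of_le_threshold F hX.cont k h2⟩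
  · rintro ⟨h1, h2⟩
    have h3 : thresholdMax F X n i ω ≤ X (i + 1) ω := by
      by_contra! hcon
      exact hne (le_antisymm (monotone_cdf F hcon.le) h1)
    exact ⟨h3, le_threshold F hX.cont k h3 hlt h2⟩

theorem IsSample.isOptimalPolicy_thresholdPolicy [IsProbabilityMeasure μ]
    (hX : IsSample μ F n X) : IsOptimalPolicy μ X n (thresholdPolicy F X n) := by
  have hS : IsPolicy X n (thresholdPolicy F X n) := isPolicy_thresholdPolicy hX.cont
  refine ⟨hS, fun T hT => ?_⟩
  rw [hX.integral_count_eq hS hX.isBellman_thresholdPolicy]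
  exact hX.integral_count_le hT

theorem IsSample.isBellman_of_isOptimalPolicy [IsProbabilityMeasure μ]
    (hX : IsSample μ F n X) (hS : IsOptimalPolicy μ X n S) : IsBellman μ F X n S := by
  refine hX.isBellman_of_le hS.1 ?_
  have hT : IsPolicy X n (thresholdPolicy F X n) := isPolicy_thresholdPolicy hX.cont
  rw [← hX.integral_count_eq hT hX.isBellman_thresholdPolicy]
  exact hS.2 _ hT

end Threshold

theorem IsBellman.residual_ae_eq {Ω : Type*} [MeasurableSpace Ω] {μ : Measure Ω} {F : Measure ℝ}
    {n : ℕ} {X : ℕ → Ω → ℝ} {S : ℕ → Set Ω} {i k : ℕ} (hB : IsBellman μ F X n S)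
    (hn : i + k + 1 = n) : residual F X S n i =ᵐ[μ]
      (fun ω => increment k (cdf F (X (i + 1) ω), position F X S i ω))
        + residual F X S n (i + 1) := by
  filter_upwards [hB i k hn] with ω hω
  rw [residual_eq F X S hn ω, policyIncrement_eq hω]
  rfl

namespace IsSample

variable {Ω : Type*} [mΩ : MeasurableSpace Ω] {μ : Measure Ω} {F : Measure ℝ}
  [IsProbabilityMeasure F] [IsProbabilityMeasure μ] {n : ℕ} {X : ℕ → Ω → ℝ}
  (hX : IsSample μ F n X) {S : ℕ → Set Ω} {i k : ℕ}
include hX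

theorem condExp_residual (hS : IsPolicy X n S) (hB : IsBellman μ F X n S) (hn : i + k = n) :
    μ[residual F X S n i|history X i] =ᵐ[μ] 0 := by
  induction k generalizing i with
  | zero =>
    obtain rfl : i = n := by omega
    have : residual F X S i i = 0 := funext fun ω => residual_self F X S i ω
    rw [this, condExp_zero]
  | succ k ih =>
    obtain ⟨h1, h2⟩ := hX.condExp_increment hS (i := i) (by omega) k
    have h3 := hX.integrable_residual hS (i := i + 1) (by omega)
    have h4 : μ[residual F X S n (i + 1)|history X i] =ᵐ[μ] 0 := by
      refine (condExp_condExp_of_le (history_mono i.le_succ)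
        (hX.history_le (i := i + 1) (by omega))).symm.trans ?_
      refine (condExp_congr_ae (ih (i := i + 1) (by omega))).trans ?_
      rw [condExp_zero]
    refine (condExp_congr_ae (hB.residual_ae_eq (k := k) (by omega))).trans ?_
    refine (condExp_add h1 h3 _).trans ?_
    filter_upwards [h2, h4] with ω a b
    simp [a, b]

/-- Orthogonality of the martingale differences, one step ahead. -/
theorem condExp_residual_sq_succ (hS : IsPolicy X n S) (hB : IsBellman μ F X n S)
    (hn : i + k + 1 = n) :
    μ[fun ω => residual F X S n i ω ^ 2|history X (i + 1)] =ᵐ[μ]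
      fun ω => increment k (cdf F (X (i + 1) ω), position F X S i ω) ^ 2
        + (μ[fun ω => residual F X S n (i + 1) ω ^ 2|history X (i + 1)]) ω := by
  set d : Ω → ℝ := fun ω => increment k (cdf F (X (i + 1) ω), position F X S i ω) with hd
  set R : Ω → ℝ := residual F X S n (i + 1) with hR
  have hi : i < n := by omega
  have hle : history X (i + 1) ≤ mΩ := hX.history_le hi
  have hZ : Measurable[history X (i + 1)] (position F X S i) :=
    (hX.measurable_position hS hi.le).mono (history_mono i.le_succ) le_rfl
  have hdm : Measurable[history X (i + 1)] d :=
    (measurable_increment k).comp (hX.measurable_unif_history.prodMk hZ)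
  have hdb : ∀ ω, |d ω| ≤ k + 2 := fun ω =>
    abs_increment_le k (cdf_mem_Icc F _) (position_mem F X S i ω)
  have hRi : Integrable R μ := hX.integrable_residual hS hi
  have hR2i : Integrable (fun ω => R ω ^ 2) μ := hX.integrable_residual_sq hS hi
  have hd2m : Measurable[history X (i + 1)] (fun ω => d ω ^ 2) := hdm.pow_const 2
  have hd2i : Integrable (fun ω => d ω ^ 2) μ := by
    refine Integrable.of_bound (C := (k + 2) ^ 2)
      (hd2m.mono hle le_rfl).aestronglyMeasurable (Eventually.of_forall fun ω => ?_)
    rw [Real.norm_eq_abs, abs_pow]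
    exact pow_le_pow_left₀ (abs_nonneg _) (hdb ω) 2
  have h2dm : Measurable[history X (i + 1)] (fun ω => 2 * d ω) := hdm.const_mul 2
  have hcross_int : Integrable ((fun ω => 2 * d ω) * R) μ := by
    refine hRi.bdd_mul (c := 2 * (k + 2)) (h2dm.mono hle le_rfl).aestronglyMeasurable
      (Eventually.of_forall fun ω => ?_)
    rw [Real.norm_eq_abs, abs_mul, abs_two]
    linarith [hdb ω]
  have hcross : μ[(fun ω => 2 * d ω) * R|history X (i + 1)] =ᵐ[μ] 0 := by
    refine (condExp_mul_of_stronglyMeasurable_left h2dm.stronglyMeasurable hcross_int hRi).trans ?_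
    filter_upwards [hX.condExp_residual hS hB (i := i + 1) (k := k) (by omega)] with ω hω
    simp [hR, hω]
  have hexp : (fun ω => residual F X S n i ω ^ 2) =ᵐ[μ]
      (fun ω => d ω ^ 2) + ((fun ω => 2 * d ω) * R + fun ω => R ω ^ 2) := by
    filter_upwards [hB.residual_ae_eq hn] with ω hω
    rw [hω]
    simp only [Pi.add_apply, Pi.mul_apply, ← hd, ← hR]
    ring
  refine (condExp_congr_ae hexp).trans ((condExp_add hd2i (hcross_int.add hR2i) _).trans ?_)
  rw [condExp_of_stronglyMeasurable hle hd2m.stronglyMeasurable hd2i]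
  filter_upwards [condExp_add hcross_int hR2i (history X (i + 1)), hcross] with ω h1 h2
  rw [Pi.add_apply, h1, Pi.add_apply, h2]
  simp [hd]

/-- The one-step estimates summed by backward induction. On the uniform scale,
`2 (1 - M_i)` is the budget for the advances of the last accepted value that are still to come. -/
theorem condExp_residual_sq_bounds (hS : IsPolicy X n S) (hB : IsBellman μ F X n S)
    (hn : i + k = n) :
    ∀ᵐ ω ∂μ, unifValue k (position F X S i ω) / 3 - 2 * (1 - position F X S i ω) ≤
        (μ[fun ω => residual F X S n i ω ^ 2|history X i]) ω ∧
      (μ[fun ω => residual F X S n i ω ^ 2|history X i]) ω ≤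
        unifValue k (position F X S i ω) / 3 + 2 / 3 * (harmonic k : ℝ) := by
  induction k generalizing i with
  | zero =>
    obtain rfl : i = n := by omega
    have : (fun ω => residual F X S i i ω ^ 2) = 0 := by
      funext ω
      simp [residual_self F X S i ω]
    rw [this, condExp_zero]
    refine Eventually.of_forall fun ω => ?_
    have := position_mem F X S i ω
    simp [unifValue]
    linarith [this.2]
  | succ k ih =>
    have hi : i < n := by omega
    have hn' : i + k + 1 = n := by omega
    have hle : history X (i + 1) ≤ mΩ := hX.history_le hi
    set V : Ω → ℝ := μ[fun ω => residual F X S n i ω ^ 2|history X (i + 1)] with hV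
    have hVi : Integrable V μ := integrable_condExp
    have htower : μ[V|history X i] =ᵐ[μ] μ[fun ω => residual F X S n i ω ^ 2|history X i] :=
      condExp_condExp_of_le (history_mono i.le_succ) hle
    have hu := (continuous_unifValue k).measurable
    have hN := measurable_nextValue k
    have hI := (measurable_increment k).pow_const 2
    have key : ∀ q : ℝ × ℝ, q.1 ∈ Icc (0 : ℝ) 1 → q.2 ∈ Icc (0 : ℝ) 1 →
        increment k q ^ 2 ∈ Icc 0 (((k : ℝ) + 2) ^ 2) ∧
          unifValue k (nextValue k q) ∈ Icc (0 : ℝ) k ∧ nextValue k q ∈ Icc (0 : ℝ) 1 := by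
      intro q h1 h2
      have hm := nextValue_mem k h1 h2
      refine ⟨⟨sq_nonneg _, ?_⟩, unifValue_mem k hm.1 hm.2, hm⟩
      rw [← sq_abs]
      exact pow_le_pow_left₀ (abs_nonneg _) (abs_increment_le k h1 h2) 2
    have hk0 : (0 : ℝ) ≤ k := k.cast_nonneg
    obtain ⟨ui, uc⟩ := hX.condExp_comp hS hi
      (φ := fun q => increment k q ^ 2 + unifValue k (nextValue k q) / 3)
      (hI.add ((hu.comp hN).div_const 3)) (C := ((k : ℝ) + 2) ^ 2 + k) (fun q h1 h2 => by
        obtain ⟨a, b, c⟩ := key q h1 h2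
        rw [abs_le]
        constructor <;> linarith [a.1, a.2, b.1, b.2])
    obtain ⟨li, lc⟩ := hX.condExp_comp hS hi
      (φ := fun q => increment k q ^ 2 + unifValue k (nextValue k q) / 3
        + 2 * (nextValue k q - 1))
      ((hI.add ((hu.comp hN).div_const 3)).add ((hN.sub_const 1).const_mul 2))
      (C := ((k : ℝ) + 2) ^ 2 + k + 2) (fun q h1 h2 => by
        obtain ⟨a, b, c⟩ := key q h1 h2
        rw [abs_le]
        constructor <;> linarith [a.1, a.2, b.1, b.2, c.1, c.2])
    have hstep := hX.condExp_residual_sq_succ hS hB hn'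
    have hih := ih (i := i + 1) (by omega)
    have hlow := condExp_mono (m := history X i) li hVi (by
      filter_upwards [hstep, hih, hB i k hn'] with ω h1 h2 h3
      rw [hV, h1, ← position_succ_eq h3]
      linarith [h2.1])
    have hupp := condExp_mono (m := history X i) hVi
      (ui.add (integrable_const (2 / 3 * (harmonic k : ℝ)))) (by
      filter_upwards [hstep, hih, hB i k hn'] with ω h1 h2 h3
      rw [hV, h1, Pi.add_apply, ← position_succ_eq h3]
      linarith [h2.2])
    have hadd := condExp_add ui (integrable_const (2 / 3 * (harmonic k : ℝ))) (history X i)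
    rw [condExp_const (hX.history_le hi.le)] at hadd
    filter_upwards [htower, hlow, hupp, hadd, uc, lc] with ω h1 h2 h3 h4 h5 h6
    have hz := position_mem F X S i ω
    rw [← h1]
    constructor
    · refine le_trans ?_ h2
      rw [h6]
      exact le_integral_increment_sq k hz
    · refine h3.trans ?_
      rw [h4, Pi.add_apply, h5]
      have := integral_increment_sq_le k hz
      rw [harmonic_succ]
      push_cast
      rw [inv_eq_one_div]
      linarith

theorem condVar_ae_eq (hS : IsPolicy X n S) (hB : IsBellman μ F X n S) (hi : i ≤ n) :
    condVar (history X i) (fun ω => count S n ω - count S i ω) μ =ᵐ[μ]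
      μ[fun ω => residual F X S n i ω ^ 2|history X i] := by
  have hle := hX.history_le hi
  set v : Ω → ℝ := fun ω => unifValue (n - i) (position F X S i ω) with hv
  have hvm : Measurable[history X i] v :=
    (continuous_unifValue _).measurable.comp (hX.measurable_position hS hi)
  have hvi : Integrable v μ := by
    refine Integrable.of_bound (C := ((n - i : ℕ) : ℝ)) (hvm.mono hle le_rfl).aestronglyMeasurable
      (Eventually.of_forall fun ω => ?_)
    have hz := position_mem F X S i ω
    have := unifValue_mem (n - i) hz.1 hz.2
    rw [Real.norm_eq_abs, abs_of_nonneg this.1]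
    exact this.2
  have hRi := hX.integrable_residual hS hi
  have hsum : (fun ω => count S n ω - count S i ω) = residual F X S n i + v := by
    funext ω
    simp [residual, hv]
  have hmean : μ[fun ω => count S n ω - count S i ω|history X i] =ᵐ[μ] v := by
    rw [hsum]
    refine (condExp_add hRi hvi _).trans ?_
    rw [condExp_of_stronglyMeasurable hle hvm.stronglyMeasurable hvi]
    filter_upwards [hX.condExp_residual hS hB (i := i) (k := n - i) (by omega)] with ω hω
    simp [hω]
  refine condExp_congr_ae ?_
  filter_upwards [hmean] with ω hω
  simp only [Pi.pow_apply, Pi.sub_apply]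
  rw [hω]
  rfl

theorem condVar_bounds (hS : IsPolicy X n S) (hB : IsBellman μ F X n S) (hi : i ≤ n) :
    ∀ᵐ ω ∂μ, (1 / 3 : ℝ) * value F (n - i) (lastSelected X S i ω) - 2 ≤
        condVar (history X i) (fun ω' => count S n ω' - count S i ω') μ ω ∧
      condVar (history X i) (fun ω' => count S n ω' - count S i ω') μ ω ≤
        (1 / 3 : ℝ) * value F (n - i) (lastSelected X S i ω)
          + (2 / 3 : ℝ) * (1 + Real.log ((n : ℝ) - (i : ℝ))) := by
  filter_upwards [hX.condVar_ae_eq hS hB hi,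
    hX.condExp_residual_sq_bounds hS hB (i := i) (k := n - i) (by omega)] with ω h1 h2
  have hz := position_mem F X S i ω
  have hh := harmonic_le_one_add_log (n - i)
  rw [Nat.cast_sub hi] at hh
  rw [h1, value_eq F hX.cont]
  rw [position] at h2 hz
  exact ⟨by linarith [h2.1, hz.1], by linarith [h2.2]⟩

theorem variance_bounds (hS : IsPolicy X n S) (hB : IsBellman μ F X n S) :
    (1 / 3 : ℝ) * (∫ ω, count S n ω ∂μ) - 2 ≤ variance (count S n) μ ∧
      variance (count S n) μ ≤
        (1 / 3 : ℝ) * (∫ ω, count S n ω ∂μ) + (2 / 3 : ℝ) * (1 + Real.log (n : ℝ)) := by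
  have hm : AEMeasurable (count S n) μ :=
    ((hS.measurable_count le_rfl).mono (hX.history_le le_rfl) le_rfl).aemeasurable
  have hbot : history X 0 = ⊥ := by simp [history]
  have hcount : (fun ω => count S n ω - count S 0 ω) = count S n := by
    funext ω
    simp [count]
  obtain ⟨ω, hω⟩ := (hX.condVar_bounds hS hB n.zero_le).exists
  rw [hcount, hbot, condVar_bot hm, Nat.sub_zero, Nat.cast_zero, sub_zero,
    value_eq F hX.cont, lastSelected, cdf_zero_eq F hX.cont hX.nonneg,
    ← hX.integral_count_eq hS hB] at hω
  exact hω

end IsSample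

end OnlineSelection

end

theorem mainTheorem2 {Ω : Type*} [MeasurableSpace Ω] (μ : Measure Ω) [IsProbabilityMeasure μ]
    (F : Measure ℝ) [IsProbabilityMeasure F]
    (hF_cont : Continuous (fun x => cdf F x)) (hF_nonneg : F (Set.Iio 0) = 0)
    (n : ℕ) (X : ℕ → Ω → ℝ)
    (hX_meas : ∀ i ∈ Finset.Icc 1 n, Measurable (X i))
    (hX_law : ∀ i ∈ Finset.Icc 1 n, μ.map (X i) = F)
    (hX_indep : iIndepFun (fun i : Finset.Icc 1 n => X i) μ) :
    OnlineSelection.IsOptimalPolicy μ X n (OnlineSelection.thresholdPolicy F X n) ∧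
    ∀ S : ℕ → Set Ω, OnlineSelection.IsOptimalPolicy μ X n S →
      (∀ i ≤ n, ∀ᵐ ω ∂μ,
        (1 / 3 : ℝ) * OnlineSelection.value F (n - i) (OnlineSelection.lastSelected X S i ω) - 2
            ≤ condVar (OnlineSelection.history X i)
                (fun ω' => OnlineSelection.count S n ω' - OnlineSelection.count S i ω') μ ω ∧
          condVar (OnlineSelection.history X i)
                (fun ω' => OnlineSelection.count S n ω' - OnlineSelection.count S i ω') μ ω
            ≤ (1 / 3 : ℝ) * OnlineSelection.value F (n - i) (OnlineSelection.lastSelected X S i ω)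
              + (2 / 3 : ℝ) * (1 + Real.log ((n : ℝ) - (i : ℝ)))) ∧
      ((1 / 3 : ℝ) * (∫ ω, OnlineSelection.count S n ω ∂μ) - 2
          ≤ variance (OnlineSelection.count S n) μ ∧
        variance (OnlineSelection.count S n) μ
          ≤ (1 / 3 : ℝ) * (∫ ω, OnlineSelection.count S n ω ∂μ)
            + (2 / 3 : ℝ) * (1 + Real.log (n : ℝ))) := by
  have hX : OnlineSelection.IsSample μ F n X := ⟨hF_cont, hF_nonneg, hX_meas, hX_law, hX_indep⟩
  refine ⟨hX.isOptimalPolicy_thresholdPolicy, fun S hS => ?_⟩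
  have hB := hX.isBellman_of_isOptimalPolicy hS
  exact ⟨fun i hi => hX.condVar_bounds hS.1 hB hi, hX.variance_bounds hS.1 hB⟩
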